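/- Let $G=(V,E)$ be a finite connected $3$-regular simple graph with a proper $3$-edge-coloring $E=E_0\sqcup E_1\sqcup E_2$ (no two distinct edges of the same $E_i$ share a vertex). For $i\in\{0,1,2\}$ let $F_i$ be the set of connected components of the graph $(V,E\setminus E_i)$. Then every member of $F_i$ is a cycle of $G$, and there are a connected closed two-manifold $\Sigma$ (compact, Hausdorff, second countable, locally homeomorphic to $\mathbb R^2$) and an embedding of $G$ in $\Sigma$ (vertices go to distinct points, edges to simple arcs that join the images of their ends and meet each other only in common ends) such that the faces, i.e. the connected components of the complement of the image of $G$, correspond bijectively to $F_0\sqcup F_1\sqcup F_2$ in the following way. (a) The face that corresponds to a cycle $K$ is the interior of a closed disk embedded in $\Sigma$ whose boundary circle is the image of $K$. (b) The closures of two distinct faces meet exactly in the images of the edges (with their ends) common to the two cycles. (c) Giving the faces that correspond to cycles of $F_i$ the color $i$ is a proper $3$-coloring of the faces: two distinct faces that share an edge have different colors. More precisely, every edge of color $i$ lies on the boundary of exactly two faces, one of each of the two colors different from $i$. -/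

import Mathlib

open Set

universe u v

section EmbeddedGraphs

variable {V : Type u} {G : SimpleGraph V}

/-- A drawing of a simple graph `G` without crossings in a (Hausdorff) space `X`: vertices go to
distinct points, each edge goes to a simple arc joining the images of its two ends, no vertex lies
in the interior of an arc, and the interiors of the arcs of distinct edges are disjoint. -/
structure GraphEmbedding (G : SimpleGraph V) (X : Type v) [TopologicalSpace X] where
  /-- The image of a vertex. -/
  vertex : V → X
  /-- The arc that represents an edge (parametrized in one of its two directions). -/
  arc : G.edgeSet → C(unitInterval, X)
  vertex_injective : Function.Injective vertex
  arc_injective : ∀ e, Function.Injective (arc e)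
  arc_ends : ∀ e : G.edgeSet, s(arc e 0, arc e 1) = (e : Sym2 V).map vertex
  vertex_notMem_interior : ∀ (e : G.edgeSet) (t : unitInterval) (w : V),
    t ∈ Ioo (0 : unitInterval) 1 → arc e t ≠ vertex w
  interior_disjoint : ∀ e e' : G.edgeSet, e ≠ e' →
    Disjoint (arc e '' Ioo (0 : unitInterval) 1) (arc e' '' Ioo (0 : unitInterval) 1)

namespace GraphEmbedding

variable {X : Type v} [TopologicalSpace X] (Γ : GraphEmbedding G X)

/-- The part of the space drawn by a set of edges (together with their ends). -/
def edgeImage (F : Set G.edgeSet) : Set X := ⋃ e ∈ F, range (Γ.arc e)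

/-- The part of the space occupied by the drawn graph. -/
def carrier : Set X := range Γ.vertex ∪ Γ.edgeImage univ

/-- The faces of an embedded graph: the connected components of its complement. -/
def Face : Type v :=
  {A : Set X // ∃ x ∈ Γ.carrierᶜ, A = connectedComponentIn Γ.carrierᶜ x}

/-- An edge lies on the boundary of a face. -/
def OnBoundary (e : G.edgeSet) (A : Γ.Face) : Prop := range (Γ.arc e) ⊆ frontier A.1

/-- Two different faces that share an edge have different colors. -/
def IsProperFaceColoring {α : Type*} (col : Γ.Face → α) : Prop :=
  ∀ (e : G.edgeSet) (A B : Γ.Face), A ≠ B → Γ.OnBoundary e A → Γ.OnBoundary e B → col A ≠ col B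

end GraphEmbedding

/-- `A` is the interior and `B` the boundary circle of a closed disk embedded in `X`. -/
def BoundsDisk {X : Type v} [TopologicalSpace X] (A B : Set X) : Prop :=
  ∃ D : Metric.closedBall (0 : EuclideanSpace ℝ (Fin 2)) 1 → X,
    Topology.IsEmbedding D ∧
    D '' {p | ‖(p : EuclideanSpace ℝ (Fin 2))‖ < 1} = A ∧
    D '' {p | ‖(p : EuclideanSpace ℝ (Fin 2))‖ = 1} = B

/-- The graph obtained by removing all edges of color `i`. -/
def deleteColor (c : G.lineGraph.Coloring (Fin 3)) (i : Fin 3) : SimpleGraph V :=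
  G.deleteEdges {e | ∃ h : e ∈ G.edgeSet, c ⟨e, h⟩ = i}

/-- The candidates for the faces: a color `i` with a connected component of the graph that is left
after removing all edges of color `i`. -/
def TwoColoredCycle (c : G.lineGraph.Coloring (Fin 3)) : Type u :=
  Σ i : Fin 3, (deleteColor c i).ConnectedComponent

namespace TwoColoredCycle

variable {c : G.lineGraph.Coloring (Fin 3)}

/-- The color whose removal produces the cycle. -/
def color (K : TwoColoredCycle c) : Fin 3 := K.1

/-- The vertices of the component. -/
def vertices (K : TwoColoredCycle c) : Set V := K.2.supp

/-- The edges of the component. -/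
def edges (K : TwoColoredCycle c) : Set G.edgeSet :=
  {e | c e ≠ K.color ∧ ∀ w ∈ (e : Sym2 V), w ∈ K.vertices}

/-- The component is (the vertex and edge set of) a cycle of `G`. -/
def IsCycle (K : TwoColoredCycle c) : Prop :=
  ∃ (a : V) (p : G.Walk a a), p.IsCycle ∧
    (∀ w, w ∈ p.support ↔ w ∈ K.vertices) ∧
    (∀ e : G.edgeSet, (e : Sym2 V) ∈ p.edges ↔ e ∈ K.edges)

end TwoColoredCycle

end EmbeddedGraphs

/-! The surface is built as a triangulation dual to the graph. Take a triangle for each vertex, with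
sides and corners numbered by the three colors, and glue the triangles of two adjacent vertices
along the side that carries the color of their edge. Side `i` is opposite to corner `i`, so only
gluings of the two colors other than `k` are made at a corner `k`. The triangles around such a
corner are therefore the vertices of one component left after deleting color `k`. That component is
a cycle, so the triangles close up to a disk, and the surface is a manifold even at the corners. The
graph is drawn with vertices at the centers and with edges crossing the common sides at their
midpoints; each face is a disk around one corner.

The triangle is modelled by `cubeCap`, the points of the unit cube whose largest coordinate is 1.
Gluing is then read off from vanishing coordinates, the drawing is where at least two coordinates
are 1, and the open face around corner `k` is where only coordinate `k` is 1.

Three facts carry the proof. `IsAlternating.exists_period`: flipping two colors in turn runs around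
a cycle of even length greater than 2. `exists_disk_complex`: polar coordinates at a corner identify
its neighborhood with a round disk of radius 3/2, in which radius 1 is the drawn cycle; this yields
both the face disks and the charts. `connectedComponentIn_eq_face`: the open faces are the
components of the complement of the drawing. Disk boundaries, intersections of closures and colors
then follow coordinatewise. -/

/-! ### Colored graphs as triples of involutions. -/

/-- Three fixed-point-free involutions of `V` that never agree at a point: the three neighbours of
a vertex in a properly 3-edge-colored cubic graph, sorted by color. -/
structure ColoredFlips (V : Type u) where
  /-- The neighbour across the edge of a given color. -/
  flip : Fin 3 → V → V
  flip_flip : ∀ i v, flip i (flip i v) = v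
  flip_ne : ∀ i v, flip i v ≠ v
  flip_injective : ∀ v, Function.Injective fun i => flip i v

namespace ColoredFlips

variable {V : Type u} (T : ColoredFlips V)

/-- `w` can be reached from `v` by flips whose colors lie in `I`. -/
def Linked (I : Set (Fin 3)) : V → V → Prop :=
  Relation.ReflTransGen fun v w => ∃ i ∈ I, T.flip i v = w

variable {T} {I J : Set (Fin 3)} {a b d : V}

theorem Linked.refl (a : V) : T.Linked I a a := Relation.ReflTransGen.refl

theorem Linked.trans (h : T.Linked I a b) (h' : T.Linked I b d) : T.Linked I a d :=
  Relation.ReflTransGen.trans h h'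

theorem linked_flip {i : Fin 3} (hi : i ∈ I) (a : V) : T.Linked I a (T.flip i a) :=
  Relation.ReflTransGen.single ⟨i, hi, rfl⟩

theorem Linked.symm (h : T.Linked I a b) : T.Linked I b a := by
  induction h with
  | refl => exact .refl a
  | tail _ hs ih =>
    obtain ⟨i, hi, rfl⟩ := hs
    refine Linked.trans ?_ ih
    simpa only [T.flip_flip] using linked_flip (T := T) hi (T.flip i _)

theorem Linked.mono (hIJ : I ⊆ J) (h : T.Linked I a b) : T.Linked J a b :=
  Relation.ReflTransGen.mono (fun _ _ ⟨i, hi, h⟩ => ⟨i, hIJ hi, h⟩) _ _ h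

/-- A flip is an involution, so a single color reaches at most two vertices. This controls the
gluing away from corners, where at most one coordinate vanishes. -/
theorem Linked.eq_or_eq_flip {i : Fin 3} (hI : ∀ l ∈ I, l = i) (h : T.Linked I a b) :
    b = a ∨ (i ∈ I ∧ b = T.flip i a) := by
  induction h with
  | refl => exact .inl rfl
  | tail _ hs ih =>
    obtain ⟨j, hj, rfl⟩ := hs
    obtain rfl := hI j hj
    rcases ih with rfl | ⟨-, rfl⟩
    · exact .inr ⟨hj, rfl⟩
    · exact .inl (T.flip_flip _ _)

theorem Linked.eq (hI : I = ∅) (h : T.Linked I a b) : b = a := by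
  subst hI
  rcases h.eq_or_eq_flip (i := 0) (by simp) with h | h
  · exact h
  · exact absurd h.1 (by simp)

end ColoredFlips

/-! ### The involutions of a properly edge-colored cubic graph. -/

section OfColoring

variable {V : Type u} {G : SimpleGraph V}

theorem eq_of_color_eq_of_mem (c : G.lineGraph.Coloring (Fin 3)) {e e' : G.edgeSet} {v : V}
    (hc : c e = c e') (h : v ∈ (e : Sym2 V)) (h' : v ∈ (e' : Sym2 V)) : e = e' := by
  by_contra hne
  exact c.valid (SimpleGraph.lineGraph_adj_iff_exists.2 ⟨hne, v, h, h'⟩) hc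

theorem eq_of_color_eq_of_adj (c : G.lineGraph.Coloring (Fin 3)) {v w w' : V} (h : G.Adj v w)
    (h' : G.Adj v w')
    (hc : c ⟨s(v, w), G.mem_edgeSet.2 h⟩ = c ⟨s(v, w'), G.mem_edgeSet.2 h'⟩) : w = w' :=
  Sym2.congr_right.1 (congrArg Subtype.val
    (eq_of_color_eq_of_mem c hc (Sym2.mem_mk_left v w) (Sym2.mem_mk_left v w')))

/-- The three edges at a vertex have distinct colors, and an injection between sets of three
elements is onto. -/
theorem exists_edge_of_color [G.LocallyFinite] (hreg : G.IsRegularOfDegree 3)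
    (c : G.lineGraph.Coloring (Fin 3)) (i : Fin 3) (v : V) :
    ∃ w, ∃ h : G.Adj v w, c ⟨s(v, w), G.mem_edgeSet.2 h⟩ = i := by
  let f : G.neighborFinset v → Fin 3 := fun w =>
    c ⟨s(v, w), G.mem_edgeSet.2 ((G.mem_neighborFinset v w).1 w.2)⟩
  have hf : Function.Injective f := fun w w' h =>
    Subtype.ext (eq_of_color_eq_of_adj c ((G.mem_neighborFinset v w).1 w.2)
      ((G.mem_neighborFinset v w').1 w'.2) h)
  have hcard : Fintype.card (G.neighborFinset v) = Fintype.card (Fin 3) := by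
    rw [Fintype.card_coe, Fintype.card_fin]
    exact hreg v
  obtain ⟨w, hw⟩ := ((Fintype.bijective_iff_injective_and_card f).2 ⟨hf, hcard⟩).2 i
  exact ⟨w, (G.mem_neighborFinset v w).1 w.2, hw⟩

theorem color_swap (c : G.lineGraph.Coloring (Fin 3)) {v w : V} (h : G.Adj v w) :
    c ⟨s(w, v), G.mem_edgeSet.2 h.symm⟩ = c ⟨s(v, w), G.mem_edgeSet.2 h⟩ :=
  congrArg c (Subtype.ext Sym2.eq_swap)

/-- The flips given by a proper 3-edge-coloring of a cubic graph. -/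
noncomputable def ColoredFlips.ofColoring [G.LocallyFinite] (hreg : G.IsRegularOfDegree 3)
    (c : G.lineGraph.Coloring (Fin 3)) : ColoredFlips V where
  flip i v := (exists_edge_of_color hreg c i v).choose
  flip_flip i v := by
    obtain ⟨h, hc⟩ := (exists_edge_of_color hreg c i v).choose_spec
    obtain ⟨h', hc'⟩ := (exists_edge_of_color hreg c i
      (exists_edge_of_color hreg c i v).choose).choose_spec
    exact eq_of_color_eq_of_adj c h' h.symm (hc'.trans ((color_swap c h).trans hc).symm)
  flip_ne i v := (exists_edge_of_color hreg c i v).choose_spec.choose.ne'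
  flip_injective v i j h := by
    obtain ⟨h1, hc1⟩ := (exists_edge_of_color hreg c i v).choose_spec
    obtain ⟨h2, hc2⟩ := (exists_edge_of_color hreg c j v).choose_spec
    rw [← hc1, ← hc2]
    exact congrArg c (Subtype.ext (congrArg (fun w => s(v, w)) h))

variable [G.LocallyFinite] (hreg : G.IsRegularOfDegree 3) (c : G.lineGraph.Coloring (Fin 3))

theorem ColoredFlips.ofColoring_adj (i : Fin 3) (v : V) :
    ∃ h : G.Adj v ((ColoredFlips.ofColoring hreg c).flip i v),
      c ⟨s(v, _), G.mem_edgeSet.2 h⟩ = i :=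
  (exists_edge_of_color hreg c i v).choose_spec

theorem ColoredFlips.ofColoring_flip_eq {v w : V} (h : G.Adj v w) :
    (ColoredFlips.ofColoring hreg c).flip (c ⟨s(v, w), G.mem_edgeSet.2 h⟩) v = w := by
  obtain ⟨h', hc⟩ := ofColoring_adj hreg c (c ⟨s(v, w), G.mem_edgeSet.2 h⟩) v
  exact eq_of_color_eq_of_adj c h' h hc

theorem reachable_deleteColor_iff (k : Fin 3) (v w : V) :
    (deleteColor c k).Reachable v w ↔
      (ColoredFlips.ofColoring hreg c).Linked {k}ᶜ v w := by
  rw [SimpleGraph.reachable_iff_reflTransGen, ColoredFlips.Linked]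
  have : (deleteColor c k).Adj =
      fun v w => ∃ i ∈ ({k}ᶜ : Set (Fin 3)), (ColoredFlips.ofColoring hreg c).flip i v = w := by
    ext v w
    simp only [deleteColor, SimpleGraph.deleteEdges_adj, Set.mem_ofPred_eq, mem_compl_iff,
      mem_singleton_iff]
    constructor
    · rintro ⟨h, hn⟩
      exact ⟨_, fun hk => hn ⟨h, hk⟩, ColoredFlips.ofColoring_flip_eq hreg c h⟩
    · rintro ⟨i, hi, rfl⟩
      obtain ⟨h, hc⟩ := ColoredFlips.ofColoring_adj hreg c i v
      exact ⟨h, fun ⟨h', hk⟩ => hi (hc.symm.trans hk)⟩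
  rw [this]

end OfColoring

/-! ### The model triangle. -/

/-- The part of the surface of the unit cube that is visible from `(1, 1, 1)`; a triangle with
corners the unit vectors, the side opposite to corner `i` being `x i = 0`. -/
def cubeCap : Set (Fin 3 → ℝ) := {x | (∀ i, 0 ≤ x i ∧ x i ≤ 1) ∧ ∃ i, x i = 1}

theorem isClosed_cubeCap : IsClosed cubeCap := by
  have : cubeCap = (⋂ i, {x : Fin 3 → ℝ | 0 ≤ x i} ∩ {x | x i ≤ 1}) ∩ ⋃ i, {x | x i = 1} := by
    ext x; simp [cubeCap]
  rw [this]
  refine (isClosed_iInter fun i => ?_).inter (isClosed_iUnion_of_finite fun i => ?_)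
  · exact (isClosed_le continuous_const (continuous_apply i)).inter
      (isClosed_le (continuous_apply i) continuous_const)
  · exact isClosed_eq (continuous_apply i) continuous_const

instance : CompactSpace cubeCap := by
  refine isCompact_iff_compactSpace.1
    ((isCompact_Icc (a := (0 : Fin 3 → ℝ)) (b := 1)).of_isClosed_subset isClosed_cubeCap
      fun x hx => ⟨fun i => (hx.1 i).1, fun i => (hx.1 i).2⟩)

theorem one_mem_cubeCap : (1 : Fin 3 → ℝ) ∈ cubeCap := ⟨fun _ => by simp, 0, rfl⟩

instance : ConnectedSpace cubeCap := by
  -- The segment from the center `1` to `x` stays in the cap because it keeps a coordinate of `x`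
  -- that equals 1.
  refine isConnected_iff_connectedSpace.1
    (StarConvex.isPathConnected (a := (1 : Fin 3 → ℝ)) ?_ one_mem_cubeCap).isConnected
  rintro x ⟨hx, k, hk⟩ a b ha hb hab
  refine ⟨fun i => ?_, k, by simp [hk, hab]⟩
  have := hx i
  simp only [Pi.add_apply, Pi.smul_apply, Pi.one_apply, smul_eq_mul, mul_one]
  constructor
  · nlinarith
  · nlinarith

theorem continuous_cubeCap_apply (i : Fin 3) : Continuous fun x : cubeCap => x.1 i :=
  (continuous_apply i).comp continuous_subtype_val

/-! ### The glued surface: Hausdorff, second countable, connected. -/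

namespace ColoredFlips

variable {V : Type u} (T : ColoredFlips V)

/-- One triangle for each vertex; the triangles of `v` and `T.flip i v` share their side `i`. -/
def gluing : Setoid ((_ : V) × cubeCap) where
  r p q := p.2 = q.2 ∧ T.Linked {i | p.2.1 i = 0} p.1 q.1
  iseqv :=
    { refl := fun _ => ⟨rfl, .refl _⟩
      symm := fun h => ⟨h.1.symm, h.1 ▸ h.2.symm⟩
      trans := fun h h' => ⟨h.1.trans h'.1, h.2.trans (h.1 ▸ h'.2)⟩ }

/-- The closed surface glued from the triangles. -/
def Surface : Type u := Quotient T.gluing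

instance : TopologicalSpace T.Surface := inferInstanceAs (TopologicalSpace (Quotient T.gluing))

/-- A point of the surface, from a triangle and a point of it. -/
def point (v : V) (x : cubeCap) : T.Surface := Quotient.mk T.gluing ⟨v, x⟩

variable {T}

theorem point_eq_iff {v w : V} {x y : cubeCap} :
    T.point v x = T.point w y ↔ x = y ∧ T.Linked {i | x.1 i = 0} v w :=
  Quotient.eq (r := T.gluing)

theorem exists_point (p : T.Surface) : ∃ v x, p = T.point v x := by
  obtain ⟨⟨v, x⟩, rfl⟩ := Quotient.exists_rep p
  exact ⟨v, x, rfl⟩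

theorem continuous_point (v : V) : Continuous (T.point v) :=
  continuous_quotient_mk'.comp continuous_sigmaMk

theorem isQuotientMap_point : Topology.IsQuotientMap
    (fun p : (_ : V) × cubeCap => T.point p.1 p.2) := isQuotientMap_quotient_mk'

instance [Finite V] : CompactSpace T.Surface :=
  inferInstanceAs (CompactSpace (Quotient T.gluing))

open Classical in
/-- Coordinates on the surface that separate points. -/
noncomputable def coords (p : (_ : V) × cubeCap) : (Fin 3 → ℝ) × (Set (Fin 3) × V → ℝ) :=
  (p.2.1, fun q => if T.Linked q.1 p.1 q.2 then ∏ k ∈ q.1.toFinsetᶜ, p.2.1 k else 0)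

/-- The coordinate of index `(I, z)` descends to the quotient: the product vanishes unless every
zero coordinate of `x` lies in `I`, and then glued vertices are linked by `I`. Choosing `I` as the
exact zero set of `x` separates points that are not glued. -/
theorem coords_eq_iff {p q : (_ : V) × cubeCap} :
    coords (T := T) p = coords (T := T) q ↔ p.2 = q.2 ∧ T.Linked {i | p.2.1 i = 0} p.1 q.1 := by
  classical
  obtain ⟨v, x⟩ := p
  obtain ⟨w, y⟩ := q
  constructor
  · intro h
    have hx : x = y := Subtype.ext (congrArg Prod.fst h)
    subst hx
    refine ⟨rfl, ?_⟩
    have h2 := congrFun (congrArg Prod.snd h) (({i | x.1 i = 0}, v))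
    have hne : ∏ k ∈ ({i | x.1 i = 0} : Set (Fin 3)).toFinsetᶜ, x.1 k ≠ 0 := by
      refine Finset.prod_ne_zero_iff.2 fun k hk => ?_
      simpa using hk
    by_contra hl
    simp only [coords] at h2
    rw [if_pos (Linked.refl v), if_neg (fun h' => hl h'.symm)] at h2
    exact hne h2
  · rintro ⟨rfl, h⟩
    refine Prod.ext rfl (funext fun ⟨I, z⟩ => ?_)
    simp only [coords]
    by_cases hp : ∏ k ∈ I.toFinsetᶜ, x.1 k = 0
    · simp [hp]
    · have hsub : {i | x.1 i = 0} ⊆ I := by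
        intro i hi
        by_contra hiI
        exact hp (Finset.prod_eq_zero (i := i) (by simpa using hiI) hi)
      have hl : T.Linked I v w := h.mono hsub
      congr 1
      exact propext ⟨fun h' => hl.symm.trans h', fun h' => hl.trans h'⟩

theorem continuous_coords : Continuous (coords (T := T)) := by
  classical
  refine continuous_sigma_iff.2 fun v => Continuous.prodMk continuous_subtype_val ?_
  refine continuous_pi fun q => ?_
  by_cases h : T.Linked q.1 v q.2
  · simp only [h, if_true]
    exact continuous_finsetProd _ fun k _ => continuous_cubeCap_apply k
  · simp only [h, if_false]
    exact continuous_const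

theorem exists_injective_coords : ∃ f : T.Surface → (Fin 3 → ℝ) × (Set (Fin 3) × V → ℝ),
    Continuous f ∧ Function.Injective f := by
  refine ⟨Quotient.lift coords fun p q h => coords_eq_iff.2 h,
    continuous_coords.quotient_lift _, ?_⟩
  intro p q
  induction p using Quotient.inductionOn
  induction q using Quotient.inductionOn
  intro h
  exact Quotient.sound (coords_eq_iff.1 h)

instance : T2Space T.Surface := by
  obtain ⟨f, hf, hi⟩ := exists_injective_coords (T := T)
  exact .of_injective_continuous hi hf

instance [Finite V] : SecondCountableTopology T.Surface := by
  obtain ⟨f, hf, hi⟩ := exists_injective_coords (T := T)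
  exact (hf.isClosedEmbedding hi).isEmbedding.secondCountableTopology

theorem point_flip {i : Fin 3} {x : cubeCap} (h : x.1 i = 0) (v : V) :
    T.point (T.flip i v) x = T.point v x :=
  (point_eq_iff.2 ⟨rfl, linked_flip (by exact h) v⟩).symm

theorem exists_cubeCap_eq_zero (i : Fin 3) :
    ∃ x : cubeCap, x.1 i = 0 ∧ ∀ l, l ≠ i → x.1 l = 1 := by
  refine ⟨⟨fun l => if l = i then 0 else 1, fun l => ?_, i + 1, ?_⟩, by simp,
    fun l hl => if_neg hl⟩
  · dsimp only
    split_ifs <;> simp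
  · fin_cases i <;> simp

theorem connectedSpace_surface [Nonempty V] (h : ∀ v w, T.Linked univ v w) :
    ConnectedSpace T.Surface := by
  have hne : Nonempty T.Surface := ⟨T.point (Classical.arbitrary V) ⟨1, one_mem_cubeCap⟩⟩
  have huniv : (⋃ v, range (T.point v)) = univ := by
    refine eq_univ_of_forall fun p => ?_
    obtain ⟨v, x, rfl⟩ := exists_point p
    exact mem_iUnion.2 ⟨v, x, rfl⟩
  have : IsPreconnected (univ : Set T.Surface) := by
    rw [← huniv]
    refine IsPreconnected.iUnion_of_reflTransGen
      (fun v => isPreconnected_range (continuous_point v)) fun v w => ?_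
    refine Relation.ReflTransGen.mono ?_ _ _ (h v w)
    rintro a b ⟨i, -, rfl⟩
    obtain ⟨x, hx, -⟩ := exists_cubeCap_eq_zero i
    exact ⟨T.point a x, ⟨x, rfl⟩, x, point_flip hx a⟩
  have : PreconnectedSpace T.Surface := ⟨this⟩
  exact ⟨hne⟩

/-! ### Subsets of the surface around a corner. -/

variable (T) in
/-- The points of the surface that lie in the part `A` of a triangle whose vertex is linked to `v`
by flips of colors other than `k`. -/
def region (k : Fin 3) (v : V) (A : Set cubeCap) : Set T.Surface :=
  {p | ∃ w x, p = T.point w x ∧ T.Linked {k}ᶜ v w ∧ x ∈ A}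

variable {k : Fin 3} {v : V} {A B : Set cubeCap}

theorem Linked.of_ne_zero {v w : V} {x : cubeCap} (hx : x.1 k ≠ 0)
    (h : T.Linked {i | x.1 i = 0} v w) : T.Linked {k}ᶜ v w :=
  h.mono fun i hi => by rintro rfl; exact hx hi

/-- Where coordinate `k` is nonzero, no gluing of color `k` occurs, so all representatives of a
point lie in the same component. Openness and closedness of a region can thus be tested triangle by
triangle. -/
theorem point_mem_region (hA : ∀ x ∈ A, x.1 k ≠ 0) {w : V} {x : cubeCap} :
    T.point w x ∈ T.region k v A ↔ T.Linked {k}ᶜ v w ∧ x ∈ A := by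
  constructor
  · rintro ⟨w', x', h', hl, hx⟩
    obtain ⟨rfl, h⟩ := point_eq_iff.1 h'
    exact ⟨hl.trans (Linked.of_ne_zero (hA _ hx) h).symm, hx⟩
  · rintro ⟨h, hx⟩
    exact ⟨w, x, rfl, h, hx⟩

theorem region_mono (h : A ⊆ B) : T.region k v A ⊆ T.region k v B := by
  rintro p ⟨w, x, rfl, hl, hx⟩
  exact ⟨w, x, rfl, hl, h hx⟩

theorem preimage_region (hA : ∀ x ∈ A, x.1 k ≠ 0) (w : V) :
    Sigma.mk w ⁻¹' ((fun p : (_ : V) × cubeCap => T.point p.1 p.2) ⁻¹' T.region k v A) =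
      {x | T.Linked {k}ᶜ v w ∧ x ∈ A} :=
  ext fun _ => point_mem_region hA

theorem isOpen_region (hA : ∀ x ∈ A, x.1 k ≠ 0) (ho : IsOpen A) : IsOpen (T.region k v A) := by
  rw [← isQuotientMap_point.isOpen_preimage, isOpen_sigma_iff]
  intro w
  rw [preimage_region hA]
  exact isOpen_const.inter ho

theorem isClosed_region (hA : ∀ x ∈ A, x.1 k ≠ 0) (ho : IsClosed A) :
    IsClosed (T.region k v A) := by
  rw [← isQuotientMap_point.isClosed_preimage, isClosed_sigma_iff]
  intro w
  rw [preimage_region hA]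
  exact isClosed_const.inter ho

end ColoredFlips

/-! ### Alternating sequences and their periods. -/

/-- The colors other than `k`, in alternation. -/
def altColor (k : Fin 3) (a : ℤ) : Fin 3 := if Even a then k + 1 else k + 2

theorem altColor_ne (k : Fin 3) (a : ℤ) : altColor k a ≠ k := by
  unfold altColor
  split_ifs <;> fin_cases k <;> simp

theorem altColor_congr (k : Fin 3) {a b : ℤ} (h : Even (a - b)) : altColor k a = altColor k b := by
  simp only [altColor, Int.even_sub.1 h]

theorem altColor_add_one_ne (k : Fin 3) (a : ℤ) : altColor k (a + 1) ≠ altColor k a := by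
  unfold altColor
  by_cases h : Even a
  · rw [if_pos h, if_neg (by simpa [Int.even_add_one] using h)]
    fin_cases k <;> simp
  · rw [if_neg h, if_pos (by simpa [Int.even_add_one] using h)]
    fin_cases k <;> simp

theorem altColor_sub_one (k : Fin 3) (a : ℤ) : altColor k (a - 1) = altColor k (a + 1) :=
  altColor_congr k (by ring_nf; decide)

theorem eq_altColor_or (k : Fin 3) (a : ℤ) (l : Fin 3) :
    l = k ∨ l = altColor k a ∨ l = altColor k (a + 1) := by
  have h1 := altColor_ne k a
  have h2 := altColor_ne k (a + 1)
  have h3 := altColor_add_one_ne k a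
  generalize altColor k a = x at *
  generalize altColor k (a + 1) = y at *
  lia

namespace ColoredFlips

variable {V : Type u} (T : ColoredFlips V)

/-- A two-sided sequence that flips the two colors other than `k` in turn. -/
def IsAlternating (k : Fin 3) (s : ℤ → V) : Prop := ∀ a, s (a + 1) = T.flip (altColor k a) (s a)

theorem exists_isAlternating (k : Fin 3) (v : V) : ∃ s, T.IsAlternating k s ∧ s 0 = v := by
  let f : ℕ → V := fun n => n.rec v fun m w => T.flip (altColor k m) w
  -- The backward step from `-m` to `-(m + 1)` must undo the forward step at `-(m + 1)`, hence the
  -- color with that index.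
  let g : ℕ → V := fun n => n.rec v fun m w => T.flip (altColor k (-(m + 1 : ℤ))) w
  refine ⟨fun a => if 0 ≤ a then f a.toNat else g (-a).toNat, fun a => ?_, rfl⟩
  dsimp only
  rcases le_or_gt 0 a with h | h
  · lift a to ℕ using h
    rw [if_pos (by lia), if_pos (by lia)]
    rfl
  · obtain ⟨m, rfl⟩ : ∃ m : ℕ, a = -(m + 1 : ℤ) := ⟨(-a - 1).toNat, by lia⟩
    have e1 : (-(-(m + 1 : ℤ))).toNat = m + 1 := by lia
    rw [if_neg (by lia : ¬ 0 ≤ -(m + 1 : ℤ)), e1]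
    change _ = T.flip _ (T.flip _ (g m))
    rw [T.flip_flip]
    rcases Nat.eq_zero_or_pos m with rfl | hm
    · rfl
    · rw [if_neg (by lia)]
      congr 1
      lia

namespace IsAlternating

variable {T} {k : Fin 3} {s : ℤ → V} (h : T.IsAlternating k s)
include h

theorem sub_one (a : ℤ) : s (a - 1) = T.flip (altColor k (a + 1)) (s a) := by
  have := h (a - 1)
  rw [sub_add_cancel, altColor_sub_one] at this
  rw [this, T.flip_flip]

theorem ne_succ (a : ℤ) : s (a + 1) ≠ s a := by
  rw [h a]; exact T.flip_ne _ _

theorem ne_add_two (a : ℤ) : s (a + 2) ≠ s a := by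
  have h1 := h (a + 1)
  have h2 := h.sub_one (a + 1)
  rw [add_sub_cancel_right] at h2
  rw [add_assoc, one_add_one_eq_two] at h1
  rw [h1, h2]
  exact fun h' => altColor_add_one_ne k (a + 1) (T.flip_injective _ h').symm

/-- If `a - b` were odd, walking forward from `a` and backward from `b` would use the same colors,
so the two walks would agree forever. They meet in the middle at two consecutive indices, giving a
fixed point of a flip. -/
theorem even_sub {a b : ℤ} (hab : s a = s b) : Even (a - b) := by
  by_contra ho
  rw [Int.not_even_iff_odd] at ho
  have key : ∀ c : ℤ, s (a + c) = s (b - c) := by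
    intro c
    induction c using Int.induction_on with
    | zero => simpa using hab
    | succ c ih =>
      rw [← add_assoc, h, ih, ← sub_sub, h.sub_one]
      congr 1
      refine altColor_congr k ?_
      have : (a + c - (b - c + 1) : ℤ) = (a - b) + 1 + 2 * (c - 1) := by ring
      rw [this]
      exact (ho.add_odd odd_one).add (even_two_mul _)
    | pred c ih =>
      rw [← add_sub_assoc, h.sub_one, ih, show b - (-(c : ℤ) - 1) = b - -(c : ℤ) + 1 by ring, h]
      congr 1
      refine altColor_congr k ?_
      have : (a + -(c : ℤ) + 1 - (b - -(c : ℤ)) : ℤ) = (a - b) + 1 + 2 * (-c) := by ring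
      rw [this]
      exact (ho.add_odd odd_one).add (even_two_mul _)
  obtain ⟨d, hd⟩ := ho
  have := key (-d)
  rw [show a + -d = b + d + 1 by lia, show b - -d = b + d by ring] at this
  exact h.ne_succ _ this

theorem add_eq_add {a b : ℤ} (hab : s a = s b) (c : ℤ) : s (a + c) = s (b + c) := by
  have he := h.even_sub hab
  induction c using Int.induction_on with
  | zero => simpa using hab
  | succ c ih =>
    rw [← add_assoc, ← add_assoc, h, h, ih]
    congr 1
    exact altColor_congr k (by convert he using 1; ring)
  | pred c ih =>
    rw [← add_sub_assoc, ← add_sub_assoc, h.sub_one, h.sub_one, ih]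
    congr 1
    exact altColor_congr k (by convert he using 1; ring)

/-- The indices `d` with `s d = s 0` form a subgroup of `ℤ`. Its generator is nonzero because `V` is
finite, even by `even_sub`, and not 2 in absolute value because the two colors never flip a vertex
to the same place. -/
theorem exists_period [Finite V] :
    ∃ n : ℕ, 2 < n ∧ Even n ∧ ∀ a b, s a = s b ↔ (n : ℤ) ∣ a - b := by
  let H : AddSubgroup ℤ :=
    { carrier := {d | s d = s 0}
      zero_mem' := rfl
      add_mem' := fun {x y} hx hy => by
        have := h.add_eq_add hx y
        rw [zero_add] at this
        exact this.trans hy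
      neg_mem' := fun {x} hx => by
        have := h.add_eq_add hx (-x)
        rw [zero_add, add_neg_cancel] at this
        exact this.symm }
  obtain ⟨g, hg⟩ := Int.subgroup_cyclic H
  have hmem : ∀ a b, s a = s b ↔ (g.natAbs : ℤ) ∣ a - b := by
    intro a b
    have h1 : a - b ∈ H ↔ g ∣ a - b := by
      rw [hg, ← AddSubgroup.zmultiples_eq_closure, Int.mem_zmultiples_iff]
    rw [Int.natAbs_dvd, ← h1]
    constructor
    · intro hab
      have := h.add_eq_add hab (-b)
      rwa [add_neg_cancel, ← sub_eq_add_neg] at this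
    · intro hab
      have := h.add_eq_add (show s (a - b) = s 0 from hab) b
      rwa [sub_add_cancel, zero_add] at this
  have heven : Even g.natAbs := by
    have := h.even_sub ((hmem g.natAbs 0).2 (by simp))
    rw [sub_zero] at this
    exact_mod_cast this
  have h0 : g.natAbs ≠ 0 := by
    intro h0
    obtain ⟨a, b, hne, hab⟩ := Finite.exists_ne_map_eq_of_infinite s
    have := (hmem a b).1 hab
    rw [h0, Nat.cast_zero, zero_dvd_iff] at this
    exact hne (by lia)
  have h2 : g.natAbs ≠ 2 := fun h2 => h.ne_add_two 0 ((hmem _ _).2 (by rw [h2]; simp))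
  refine ⟨g.natAbs, ?_, heven, hmem⟩
  rcases heven with ⟨r, hr⟩
  lia

theorem linked_iff (w : V) : T.Linked {k}ᶜ (s 0) w ↔ ∃ a, s a = w := by
  constructor
  · intro hl
    induction hl with
    | refl => exact ⟨0, rfl⟩
    | tail _ hs ih =>
      obtain ⟨i, hi, rfl⟩ := hs
      obtain ⟨a, rfl⟩ := ih
      rcases eq_altColor_or k a i with rfl | rfl | rfl
      · exact absurd rfl hi
      · exact ⟨a + 1, h a⟩
      · exact ⟨a - 1, h.sub_one a⟩
  · rintro ⟨a, rfl⟩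
    induction a using Int.induction_on with
    | zero => exact .refl _
    | succ a ih => rw [h]; exact ih.trans (linked_flip (altColor_ne k _) _)
    | pred a ih => rw [h.sub_one]; exact ih.trans (linked_flip (altColor_ne k _) _)

theorem exists_lt_of_period {n : ℕ} (hn : 0 < n) (hs : ∀ a b, s a = s b ↔ (n : ℤ) ∣ a - b) {w : V}
    (hw : T.Linked {k}ᶜ (s 0) w) : ∃ a : ℕ, a < n ∧ s a = w := by
  obtain ⟨a, rfl⟩ := (h.linked_iff w).1 hw
  have h1 := Int.emod_nonneg a (b := n) (by lia)
  have h2 := Int.emod_lt_of_pos a (b := n) (by lia)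
  refine ⟨(a % n).toNat, by lia, (hs _ _).2 ?_⟩
  rw [Int.toNat_of_nonneg h1]
  exact ⟨-(a / n), by linarith [Int.emod_add_mul_ediv a n]⟩

end IsAlternating

end ColoredFlips

/-! ### Polar coordinates in the plane. -/

/-- Both targets are quotients of the same compact space by the same relation. It is applied to
compare a plane disk with a neighborhood of a corner. -/
theorem exists_homeomorph_of_fibers {X Y Z : Type*} [TopologicalSpace X] [TopologicalSpace Y]
    [TopologicalSpace Z] [CompactSpace X] [T2Space Y] [T2Space Z] {f : X → Y} {g : X → Z}
    (hf : Continuous f) (hg : Continuous g) (sf : Function.Surjective f)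
    (sg : Function.Surjective g) (h : ∀ x x', f x = f x' ↔ g x = g x') :
    ∃ e : Y ≃ₜ Z, ∀ x, e (f x) = g x := by
  have hq : Topology.IsQuotientMap f := hf.isClosedMap.isQuotientMap hf sf
  let E : Y → Z := fun y => g (Function.surjInv sf y)
  have hE : ∀ x, E (f x) = g x := fun x => (h _ _).1 (Function.surjInv_eq sf (f x))
  have hc : Continuous E := hq.continuous_iff.2 (by
    rw [show E ∘ f = g from funext hE]; exact hg)
  have hb : Function.Bijective E := by
    refine ⟨fun y y' hy => ?_, fun z => ?_⟩
    · obtain ⟨x, rfl⟩ := sf y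
      obtain ⟨x', rfl⟩ := sf y'
      rw [hE, hE] at hy
      exact (h _ _).2 hy
    · obtain ⟨x, rfl⟩ := sg z
      exact ⟨f x, hE x⟩
  have : CompactSpace Y := ⟨by rw [← sf.range_eq]; exact isCompact_range hf⟩
  exact ⟨Continuous.homeoOfEquivCompactToT2 (f := Equiv.ofBijective E hb) hc, hE⟩

/-- The point at distance `r` from the origin in direction `θ`, where a full turn is `n`. -/
noncomputable def polarPoint (n : ℕ) (θ r : ℝ) : ℂ :=
  r * Complex.exp ((2 * Real.pi * θ / n : ℝ) * Complex.I)

theorem norm_polarPoint {n : ℕ} {θ r : ℝ} (hr : 0 ≤ r) : ‖polarPoint n θ r‖ = r := by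
  rw [polarPoint, norm_mul, Complex.norm_exp_ofReal_mul_I, mul_one, Complex.norm_real,
    Real.norm_of_nonneg hr]

theorem polarPoint_eq_iff {n : ℕ} (hn : 0 < n) {θ θ' r r' : ℝ} (hr : 0 ≤ r) (hr' : 0 ≤ r') :
    polarPoint n θ r = polarPoint n θ' r' ↔
      r = r' ∧ (r = 0 ∨ ∃ N : ℤ, θ = θ' + N * n) := by
  have hn' : (n : ℝ) ≠ 0 := by positivity
  have key : Complex.exp ((2 * Real.pi * θ / n : ℝ) * Complex.I) =
      Complex.exp ((2 * Real.pi * θ' / n : ℝ) * Complex.I) ↔ ∃ N : ℤ, θ = θ' + N * n := by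
    rw [Complex.exp_eq_exp_iff_exists_int]
    refine exists_congr fun N => ?_
    rw [show ((2 * Real.pi * θ' / n : ℝ) : ℂ) * Complex.I + N * (2 * Real.pi * Complex.I) =
      ((2 * Real.pi * θ' / n + N * (2 * Real.pi) : ℝ) : ℂ) * Complex.I by push_cast; ring,
      mul_left_inj' Complex.I_ne_zero, Complex.ofReal_inj]
    have hpi := Real.pi_ne_zero
    constructor
    · intro h
      field_simp at h
      linarith
    · rintro rfl
      field_simp
  constructor
  · intro h
    have hrr : r = r' := by rw [← norm_polarPoint (n := n) (θ := θ) hr, h, norm_polarPoint hr']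
    subst hrr
    refine ⟨rfl, or_iff_not_imp_left.2 fun h0 => key.1 ?_⟩
    exact mul_left_cancel₀ (Complex.ofReal_ne_zero.2 h0) h
  · rintro ⟨rfl, rfl | h⟩
    · simp [polarPoint]
    · rw [polarPoint, key.2 h, polarPoint]

theorem exists_polarPoint_eq {n : ℕ} (hn : 0 < n) (z : ℂ) :
    ∃ (a : Fin n) (t : unitInterval), polarPoint n ((a : ℕ) + t) ‖z‖ = z := by
  have hn' : (0 : ℝ) < n := by exact_mod_cast hn
  set θ : ℝ := n * (Complex.arg z / (2 * Real.pi)) with hθ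
  set φ : ℝ := n * Int.fract (Complex.arg z / (2 * Real.pi)) with hφ
  have h0 : 0 ≤ φ := mul_nonneg hn'.le (Int.fract_nonneg _)
  have h1 : φ < n := by
    have := Int.fract_lt_one (Complex.arg z / (2 * Real.pi))
    rw [hφ]; nlinarith
  have hz : polarPoint n θ ‖z‖ = z := by
    rw [polarPoint, show 2 * Real.pi * θ / n = z.arg by
      rw [hθ]; have := Real.pi_ne_zero; field_simp]
    exact Complex.norm_mul_exp_arg_mul_I z
  refine ⟨⟨⌊φ⌋₊, (Nat.floor_lt h0).2 h1⟩, ⟨φ - ⌊φ⌋₊, by linarith [Nat.floor_le h0],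
    by linarith [Nat.lt_floor_add_one φ]⟩, ?_⟩
  refine Eq.trans ?_ hz
  refine (polarPoint_eq_iff hn (norm_nonneg _) (norm_nonneg _)).2
    ⟨rfl, .inr ⟨-⌊Complex.arg z / (2 * Real.pi)⌋, ?_⟩⟩
  simp only [hφ, hθ, Int.fract]
  push_cast
  ring

/-! ### Polar coordinates in a triangle around a corner. -/

/-- The weight at `t` of the second end of a quarter turn in the max norm. -/
noncomputable def ramp (t : ℝ) : ℝ := min 1 (2 * t)

/-- The pair `(ramp (1 - t), ramp t)` runs along the max-norm unit quarter circle from `(1, 0)`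
through `(1, 1)` to `(0, 1)`; the difference of its entries recovers `t`. -/
theorem ramp_sub_ramp (t : ℝ) : ramp t - ramp (1 - t) = 2 * t - 1 := by
  simp only [ramp, min_def]
  split_ifs <;> linarith

theorem max_ramp (t : ℝ) : max (ramp (1 - t)) (ramp t) = 1 := by
  simp only [ramp, min_def, max_def]
  split_ifs <;> linarith

theorem ramp_mem {t : ℝ} (h0 : 0 ≤ t) : 0 ≤ ramp t ∧ ramp t ≤ 1 :=
  ⟨le_min zero_le_one (by linarith), min_le_left _ _⟩

theorem ramp_eq_zero {t : ℝ} : ramp t = 0 ↔ t = 0 := by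
  simp only [ramp, min_def]
  split_ifs
  · constructor <;> intro h <;> linarith
  · constructor <;> intro h <;> linarith

/-- Distance to corner `k`, adapted to the max norm. -/
noncomputable def cornerRadius (k : Fin 3) (x : Fin 3 → ℝ) : ℝ :=
  max (x (k + 1)) (x (k + 2)) + (1 - x k)

theorem cornerRadius_altColor (k : Fin 3) (a : ℤ) (x : Fin 3 → ℝ) :
    cornerRadius k x = max (x (altColor k a)) (x (altColor k (a + 1))) + (1 - x k) := by
  by_cases h : Even a
  · have h' : ¬ Even (a + 1) := by simpa [Int.even_add_one] using h
    rw [altColor, altColor, if_pos h, if_neg h', cornerRadius]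
  · have h' : Even (a + 1) := by simpa [Int.even_add_one] using h
    rw [altColor, altColor, if_neg h, if_pos h', cornerRadius, max_comm]

/-- Polar coordinates around corner `k`; at `t = 1` the coordinate `l` vanishes, at `t = 0` the
remaining one. -/
noncomputable def coneCoord (k l : Fin 3) (t r : ℝ) : Fin 3 → ℝ := fun j =>
  if j = k then min 1 (2 - r) else if j = l then min 1 r * ramp (1 - t) else min 1 r * ramp t

section coneCoord

variable (k : Fin 3) (a : ℤ) (t r : ℝ)

theorem coneCoord_self (l : Fin 3) : coneCoord k l t r k = min 1 (2 - r) := if_pos rfl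

theorem coneCoord_altColor :
    coneCoord k (altColor k a) t r (altColor k a) = min 1 r * ramp (1 - t) := by
  rw [coneCoord, if_neg (altColor_ne k a), if_pos rfl]

theorem coneCoord_altColor_succ :
    coneCoord k (altColor k a) t r (altColor k (a + 1)) = min 1 r * ramp t := by
  rw [coneCoord, if_neg (altColor_ne k _), if_neg (altColor_add_one_ne k a)]

/-- Up to radius 1 the two other coordinates grow while coordinate `k` stays 1; beyond radius 1
their maximum stays 1 and coordinate `k` falls. Exactly one summand varies at a time. -/
theorem cornerRadius_coneCoord {r : ℝ} (hr : 0 ≤ r) :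
    cornerRadius k (coneCoord k (altColor k a) t r) = r := by
  rw [cornerRadius_altColor k a, coneCoord_self, coneCoord_altColor, coneCoord_altColor_succ,
    ← mul_max_of_nonneg _ _ (le_min zero_le_one hr), max_ramp]
  simp only [min_def]
  split_ifs <;> linarith

theorem coneCoord_mem {t r : ℝ} (ht : t ∈ Icc (0 : ℝ) 1) (hr : r ∈ Icc (0 : ℝ) (3 / 2)) :
    coneCoord k (altColor k a) t r ∈ cubeCap := by
  have h1 := ramp_mem ht.1
  have h2 := ramp_mem (sub_nonneg.2 ht.2)
  have h3 : 0 ≤ min 1 r := le_min zero_le_one hr.1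
  have h4 : min 1 r ≤ 1 := min_le_left _ _
  constructor
  · intro j
    rcases eq_altColor_or k a j with rfl | rfl | rfl
    · rw [coneCoord_self]
      exact ⟨le_min zero_le_one (by linarith [hr.2]), min_le_left _ _⟩
    · rw [coneCoord_altColor]
      exact ⟨mul_nonneg h3 h2.1, mul_le_one₀ h4 h2.1 h2.2⟩
    · rw [coneCoord_altColor_succ]
      exact ⟨mul_nonneg h3 h1.1, mul_le_one₀ h4 h1.1 h1.2⟩
  · rcases le_total r 1 with h | h
    · exact ⟨k, by rw [coneCoord_self]; exact min_eq_left (by linarith)⟩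
    · rcases max_choice (ramp (1 - t)) (ramp t) with hm | hm
      · refine ⟨altColor k a, ?_⟩
        rw [coneCoord_altColor, min_eq_left h, ← hm, max_ramp, one_mul]
      · refine ⟨altColor k (a + 1), ?_⟩
        rw [coneCoord_altColor_succ, min_eq_left h, ← hm, max_ramp, one_mul]

theorem continuous_coneCoord (l : Fin 3) : Continuous fun p : ℝ × ℝ => coneCoord k l p.1 p.2 := by
  refine continuous_pi fun j => ?_
  simp only [coneCoord, ramp]
  split_ifs <;> fun_prop

end coneCoord

theorem exists_coneCoord_eq {k : Fin 3} (a : ℤ) {x : Fin 3 → ℝ} (hx : x ∈ cubeCap)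
    (hk : 1 / 2 ≤ x k) :
    ∃ t ∈ Icc (0 : ℝ) 1, ∃ r ∈ Icc (0 : ℝ) (3 / 2), coneCoord k (altColor k a) t r = x := by
  obtain ⟨h01, j, hj⟩ := hx
  set p := x (altColor k a) with hp
  set q := x (altColor k (a + 1)) with hq
  set M := max p q with hM
  have hp1 := h01 (altColor k a)
  have hq1 := h01 (altColor k (a + 1))
  have hk1 := h01 k
  rw [← hp] at hp1
  rw [← hq] at hq1
  have hM0 : 0 ≤ M := le_max_of_le_left hp1.1
  have hM1 : M ≤ 1 := max_le hp1.2 hq1.2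
  have hor : x k = 1 ∨ M = 1 := by
    rcases eq_altColor_or k a j with rfl | rfl | rfl
    · exact .inl hj
    · exact .inr (le_antisymm hM1 (hj ▸ le_max_left _ _))
    · exact .inr (le_antisymm hM1 (hj ▸ le_max_right _ _))
  have hr1 : min 1 (M + 1 - x k) = M := by
    rcases hor with h | h
    · rw [h, add_sub_cancel_right, min_eq_right hM1]
    · rw [h]; exact min_eq_left (by linarith)
  have hr2 : min 1 (2 - (M + 1 - x k)) = x k := by
    rcases hor with h | h
    · rw [h]; exact min_eq_left (by linarith)
    · rw [h]; rw [min_eq_right] <;> linarith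
  have hr : M + 1 - x k ∈ Icc (0 : ℝ) (3 / 2) := by
    refine ⟨by linarith, by linarith⟩
  -- The angle comes from the ratio of the smaller to the larger coordinate, halved because `ramp`
  -- has slope 2; if both vanish any angle works.
  have main : ∃ t ∈ Icc (0 : ℝ) 1, M * ramp (1 - t) = p ∧ M * ramp t = q := by
    rcases hM0.eq_or_lt with h | h
    · have := le_max_left p q
      have := le_max_right p q
      refine ⟨0, by simp, ?_, ?_⟩ <;> rw [← h, zero_mul] <;> linarith
    · rcases le_total p q with hpq | hpq
      · have hMq : M = q := max_eq_right hpq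
        rw [hMq] at h ⊢
        have h1 : p / q ≤ 1 := div_le_one_of_le₀ hpq hq1.1
        have h0 : 0 ≤ p / q := div_nonneg hp1.1 hq1.1
        refine ⟨1 - p / q / 2, ⟨by linarith, by linarith⟩, ?_, ?_⟩
        · rw [ramp, sub_sub_cancel, min_eq_right (by linarith)]
          field_simp
        · rw [ramp, min_eq_left (by linarith), mul_one]
      · have hMp : M = p := max_eq_left hpq
        rw [hMp] at h ⊢
        have h1 : q / p ≤ 1 := div_le_one_of_le₀ hpq hp1.1
        have h0 : 0 ≤ q / p := div_nonneg hq1.1 hp1.1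
        refine ⟨q / p / 2, ⟨by linarith, by linarith⟩, ?_, ?_⟩
        · rw [ramp, min_eq_left (by linarith), mul_one]
        · rw [ramp, min_eq_right (by linarith)]
          field_simp
  obtain ⟨t, ht, htp, htq⟩ := main
  refine ⟨t, ht, M + 1 - x k, hr, funext fun l => ?_⟩
  rcases eq_altColor_or k a l with rfl | rfl | rfl
  · rw [coneCoord_self, hr2]
  · rw [coneCoord_altColor, hr1, htp]
  · rw [coneCoord_altColor_succ, hr1, htq]

/-! ### The disk around a corner of the surface. -/

namespace ColoredFlips

variable {V : Type u} {T : ColoredFlips V} {k : Fin 3} {s : ℤ → V}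

/-- Polar coordinates on the surface around a corner. -/
noncomputable def conePoint (T : ColoredFlips V) (k : Fin 3) (s : ℤ → V) (a : ℤ)
    (t : unitInterval) (r : Icc (0 : ℝ) (3 / 2)) : T.Surface :=
  T.point (s a) ⟨coneCoord k (altColor k a) t r, coneCoord_mem k a t.2 r.2⟩

theorem continuous_conePoint (a : ℤ) :
    Continuous fun p : unitInterval × Icc (0 : ℝ) (3 / 2) => T.conePoint k s a p.1 p.2 := by
  refine (continuous_point (s a)).comp (Continuous.subtype_mk ?_ _)
  exact (continuous_coneCoord k (altColor k a)).comp
    ((continuous_subtype_val.comp continuous_fst).prodMk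
      (continuous_subtype_val.comp continuous_snd))

namespace IsAlternating

variable (h : T.IsAlternating k s)
include h

theorem conePoint_congr {a b : ℤ} (hab : s a = s b) (t : unitInterval)
    (r : Icc (0 : ℝ) (3 / 2)) : T.conePoint k s a t r = T.conePoint k s b t r := by
  simp only [conePoint, hab, altColor_congr k (h.even_sub hab)]

theorem conePoint_succ (a : ℤ) (r : Icc (0 : ℝ) (3 / 2)) :
    T.conePoint k s (a + 1) 0 r = T.conePoint k s a 1 r := by
  have hz : coneCoord k (altColor k a) (1 : unitInterval) r (altColor k a) = 0 := by
    rw [coneCoord_altColor, ramp_eq_zero.2 (by simp), mul_zero]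
  have hx : coneCoord k (altColor k (a + 1)) (0 : unitInterval) r =
      coneCoord k (altColor k a) (1 : unitInterval) r := by
    funext l
    rcases eq_altColor_or k a l with rfl | rfl | rfl
    · rw [coneCoord_self, coneCoord_self]
    · rw [hz, altColor_congr k (a := a) (b := a + 1 + 1) ⟨-1, by ring⟩, coneCoord_altColor_succ,
        ramp_eq_zero.2 (by simp), mul_zero]
    · rw [coneCoord_altColor, coneCoord_altColor_succ]
      simp
  simp only [conePoint, hx, h a]
  exact point_flip hz _

/-- These are the identifications of plane polar coordinates: radius 0 is one point, and otherwise
the total angle `a + t` counts modulo the number `n` of triangles around the corner. -/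
theorem conePoint_eq_iff {n : ℕ} (hs : ∀ a b, s a = s b ↔ (n : ℤ) ∣ a - b) {a b : ℤ}
    {t t' : unitInterval} {r r' : Icc (0 : ℝ) (3 / 2)} :
    T.conePoint k s a t r = T.conePoint k s b t' r' ↔
      (r : ℝ) = r' ∧ ((r : ℝ) = 0 ∨ ∃ N : ℤ, (a + t : ℝ) = (b + t') + N * n) := by
  constructor
  · intro heq
    obtain ⟨hx, hl⟩ := point_eq_iff.1 heq
    have hx : coneCoord k (altColor k a) t r = coneCoord k (altColor k b) t' r' :=
      congrArg Subtype.val hx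
    have hr : (r : ℝ) = r' := by
      rw [← cornerRadius_coneCoord k a t r.2.1, hx, cornerRadius_coneCoord k b t' r'.2.1]
    have hr := Subtype.ext hr
    subst hr
    refine ⟨rfl, or_iff_not_imp_left.2 fun h0 => ?_⟩
    have hpos : 0 < min 1 (r : ℝ) := lt_min one_pos (lt_of_le_of_ne r.2.1 (Ne.symm h0))
    -- The bound 3/2 on the radius keeps coordinate `k` positive, so off the corner only the two
    -- sides `t = 1` and `t = 0` of the sector are glued.
    have hZ : ∀ i ∈ {i | coneCoord k (altColor k a) t r i = 0},
        (i = altColor k a ∧ (t : ℝ) = 1) ∨ (i = altColor k (a + 1) ∧ (t : ℝ) = 0) := by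
      intro i (hi : coneCoord k (altColor k a) t r i = 0)
      rcases eq_altColor_or k a i with rfl | rfl | rfl
      · rw [coneCoord_self, min_def] at hi
        have := r.2.2
        split_ifs at hi <;> linarith
      · rw [coneCoord_altColor, mul_eq_zero, ramp_eq_zero] at hi
        exact .inl ⟨rfl, by linarith [hi.resolve_left hpos.ne']⟩
      · rw [coneCoord_altColor_succ, mul_eq_zero, ramp_eq_zero] at hi
        exact .inr ⟨rfl, hi.resolve_left hpos.ne'⟩
    have hsame : s b = s a → (t : ℝ) = t' := by
      intro hab
      have hc := altColor_congr k (h.even_sub hab)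
      have hc' := altColor_congr k (a := b + 1) (b := a + 1)
        (by simpa using h.even_sub hab)
      have e1 := congrFun hx (altColor k a)
      have e2 := congrFun hx (altColor k (a + 1))
      rw [coneCoord_altColor, ← hc, coneCoord_altColor] at e1
      rw [coneCoord_altColor_succ, ← hc', coneCoord_altColor_succ] at e2
      have e1 := mul_left_cancel₀ hpos.ne' e1
      have e2 := mul_left_cancel₀ hpos.ne' e2
      have := ramp_sub_ramp t
      have := ramp_sub_ramp t'
      linarith
    have hN : ∀ {c d : ℤ}, s c = s d → ∃ N : ℤ, (c : ℝ) = d + N * n := by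
      intro c d hcd
      obtain ⟨N, hN⟩ := (hs c d).1 hcd
      refine ⟨N, ?_⟩
      have : c = d + N * n := by linarith
      exact_mod_cast this
    have hcase : s b = s a ∨ (s b = s (a + 1) ∧ (t : ℝ) = 1) ∨ (s b = s (a - 1) ∧ (t : ℝ) = 0) := by
      rcases eq_or_ne (t : ℝ) 1 with ht | ht
      · rcases hl.eq_or_eq_flip (i := altColor k a) (fun i hi => by
          rcases hZ i hi with h' | h'
          · exact h'.1
          · linarith [h'.2]) with h' | ⟨-, h'⟩
        · exact .inl h'
        · exact .inr (.inl ⟨by rw [h', h a], ht⟩)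
      · rcases hl.eq_or_eq_flip (i := altColor k (a + 1)) (fun i hi => by
          rcases hZ i hi with h' | h'
          · exact absurd h'.2 ht
          · exact h'.1) with h' | ⟨hi, h'⟩
        · exact .inl h'
        · refine .inr (.inr ⟨by rw [h', h.sub_one], ?_⟩)
          rcases hZ _ hi with h' | h'
          · exact absurd h'.2 ht
          · exact h'.2
    rcases hcase with hab | ⟨hab, ht⟩ | ⟨hab, ht⟩
    · obtain ⟨N, hN⟩ := hN hab.symm
      exact ⟨N, by rw [hsame hab]; linarith⟩
    · have hev := h.even_sub hab
      have e1 := congrFun hx (altColor k a)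
      have hc : altColor k a = altColor k (b + 1) :=
        altColor_congr k (by
          have : a - (b + 1) = -(b - (a + 1)) + 2 * (-1) := by ring
          rw [this]
          exact hev.neg.add (even_two_mul _))
      rw [coneCoord_altColor, ramp_eq_zero.2 (by linarith), mul_zero, hc, coneCoord_altColor_succ,
        eq_comm, mul_eq_zero, ramp_eq_zero] at e1
      have e1 := e1.resolve_left hpos.ne'
      obtain ⟨N, hN⟩ := hN hab.symm
      push_cast at hN
      exact ⟨N, by linarith⟩
    · have hev := h.even_sub hab
      have e1 := congrFun hx (altColor k (a + 1))
      have hc : altColor k (a + 1) = altColor k b :=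
        altColor_congr k (by
          have : a + 1 - b = -(b - (a - 1)) + 2 * 1 := by ring
          rw [this]
          exact hev.neg.add (even_two_mul _))
      rw [coneCoord_altColor_succ, ramp_eq_zero.2 ht, mul_zero, hc, coneCoord_altColor,
        eq_comm, mul_eq_zero, ramp_eq_zero] at e1
      have e1 := e1.resolve_left hpos.ne'
      obtain ⟨N, hN⟩ := hN hab.symm
      push_cast at hN
      exact ⟨N, by linarith⟩
  · rintro ⟨hr, h0 | ⟨N, hN⟩⟩
    · have hr := Subtype.ext hr
      subst hr
      have hx : ∀ (c : ℤ) (τ : unitInterval),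
          coneCoord k (altColor k c) τ r = fun l => if l = k then 1 else 0 := by
        intro c τ
        funext l
        simp only [coneCoord, h0]
        split_ifs <;> simp
      have hl : T.Linked {k}ᶜ (s a) (s b) :=
        ((h.linked_iff _).2 ⟨a, rfl⟩).symm.trans ((h.linked_iff _).2 ⟨b, rfl⟩)
      refine point_eq_iff.2 ⟨Subtype.ext ((hx a t).trans (hx b t').symm), hl.mono fun i hi => ?_⟩
      change coneCoord k (altColor k a) t r i = 0
      rw [hx a t]
      exact if_neg hi
    · have hr := Subtype.ext hr
      subst hr
      have ht := t.2
      have ht' := t'.2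
      have hd : ((a - b - N * n : ℤ) : ℝ) = t' - t := by push_cast; linarith
      have hle : a - b - N * n ≤ 1 := by
        have : ((a - b - N * n : ℤ) : ℝ) ≤ 1 := by rw [hd]; linarith [ht.1, ht'.2]
        exact_mod_cast this
      have hge : -1 ≤ a - b - N * n := by
        have : (-1 : ℝ) ≤ ((a - b - N * n : ℤ) : ℝ) := by rw [hd]; linarith [ht'.1, ht.2]
        exact_mod_cast this
      -- The integer equals `t' - t` and so has absolute value at most 1: the sectors coincide
      -- modulo `n`, or they are neighbors that meet along a side.
      have h3 : a - b - N * n = 0 ∨ a - b - N * n = 1 ∨ a - b - N * n = -1 := by lia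
      rcases h3 with h3 | h3 | h3 <;> rw [h3] at hd <;> push_cast at hd
      · have : t = t' := Subtype.ext (by linarith)
        subst this
        exact h.conePoint_congr ((hs a b).2 ⟨N, by linarith⟩) t r
      · have e1 : t = 0 := Subtype.ext (show (t : ℝ) = 0 by linarith [ht.1, ht'.2])
        have e2 : t' = 1 := Subtype.ext (show (t' : ℝ) = 1 by linarith [ht.1, ht'.2])
        subst e1 e2
        rw [← h.conePoint_succ]
        exact h.conePoint_congr ((hs _ _).2 ⟨N, by linarith⟩) _ r
      · have e1 : t = 1 := Subtype.ext (show (t : ℝ) = 1 by linarith [ht'.1, ht.2])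
        have e2 : t' = 0 := Subtype.ext (show (t' : ℝ) = 0 by linarith [ht'.1, ht.2])
        subst e1 e2
        rw [← h.conePoint_succ]
        exact h.conePoint_congr ((hs _ _).2 ⟨N, by linarith⟩) _ r

end IsAlternating

/-- The part of the surface around a corner is a disk. -/
theorem exists_disk_complex [Finite V] (T : ColoredFlips V) (k : Fin 3) (v : V) :
    ∃ D : Metric.closedBall (0 : ℂ) (3 / 2) → T.Surface, Topology.IsEmbedding D ∧
      ∀ R : Set ℝ, D '' {p | ‖(p : ℂ)‖ ∈ R} =
        T.region k v {x | 1 / 2 ≤ x.1 k ∧ cornerRadius k x.1 ∈ R} := by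
  obtain ⟨s, h, rfl⟩ := T.exists_isAlternating k v
  obtain ⟨n, hn2, -, hs⟩ := h.exists_period
  have hn : 0 < n := by lia
  -- One rectangle of polar coordinates for each triangle at the corner. `f` maps them onto the
  -- plane disk and `g` onto the neighborhood `M` of the corner, with the same fibers. The radius
  -- 3/2 exceeds 1, so the drawn cycle lies in the interior of the disk.
  let X := (_ : Fin n) × (unitInterval × Icc (0 : ℝ) (3 / 2))
  let f : X → Metric.closedBall (0 : ℂ) (3 / 2) := fun p =>
    ⟨polarPoint n ((p.1 : ℕ) + p.2.1) p.2.2, by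
      rw [mem_closedBall_zero_iff, norm_polarPoint p.2.2.2.1]; exact p.2.2.2.2⟩
  let M : Set T.Surface := T.region k (s 0) {x | 1 / 2 ≤ x.1 k}
  let g : X → M := fun p => ⟨T.conePoint k s (p.1 : ℕ) p.2.1 p.2.2,
    _, _, rfl, (h.linked_iff _).2 ⟨_, rfl⟩, by
      change _ ≤ coneCoord _ _ _ _ _
      rw [coneCoord_self]
      exact le_min (by norm_num) (by linarith [p.2.2.2.2])⟩
  have hf : Continuous f := by
    refine continuous_sigma_iff.2 fun a => Continuous.subtype_mk ?_ _
    simp only [polarPoint]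
    fun_prop
  have hg : Continuous g :=
    continuous_sigma_iff.2 fun a => Continuous.subtype_mk
      (continuous_conePoint (T := T) (k := k) (s := s) ((a : ℕ) : ℤ)) _
  have sf : Function.Surjective f := by
    rintro ⟨z, hz⟩
    obtain ⟨a, t, hat⟩ := exists_polarPoint_eq hn z
    exact ⟨⟨a, t, ‖z‖, norm_nonneg _, mem_closedBall_zero_iff.1 hz⟩, Subtype.ext hat⟩
  have sg : Function.Surjective g := by
    rintro ⟨_, w, x, rfl, hl, hx⟩
    obtain ⟨a, han, rfl⟩ := h.exists_lt_of_period hn hs hl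
    obtain ⟨t, ht, r, hr, hx⟩ := exists_coneCoord_eq a x.2 hx
    exact ⟨⟨⟨a, han⟩, ⟨t, ht⟩, ⟨r, hr⟩⟩, Subtype.ext
      (congrArg (T.point (s a)) (Subtype.ext hx))⟩
  obtain ⟨e, he⟩ := exists_homeomorph_of_fibers hf hg sf sg fun p q => by
    rw [Subtype.ext_iff, Subtype.ext_iff, polarPoint_eq_iff hn p.2.2.2.1 q.2.2.2.1,
      h.conePoint_eq_iff hs]
    simp only [Int.cast_natCast]
  have hnorm : ∀ p, ‖(f p : ℂ)‖ = p.2.2 := fun p => norm_polarPoint p.2.2.2.1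
  refine ⟨fun p => e p, Topology.IsEmbedding.subtypeVal.comp e.isEmbedding, fun R => ?_⟩
  apply Subset.antisymm
  · rintro _ ⟨p, hp, rfl⟩
    obtain ⟨q, rfl⟩ := sf p
    rw [Set.mem_ofPred_eq, hnorm] at hp
    dsimp only
    rw [he]
    refine ⟨_, _, rfl, (h.linked_iff _).2 ⟨_, rfl⟩, ?_, ?_⟩
    · change _ ≤ coneCoord _ _ _ _ _
      rw [coneCoord_self]
      exact le_min (by norm_num) (by linarith [q.2.2.2.2])
    · rwa [cornerRadius_coneCoord _ _ _ q.2.2.2.1]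
  · rintro _ ⟨w, x, rfl, hl, hx, hR⟩
    obtain ⟨q, hq⟩ := sg ⟨T.point w x, w, x, rfl, hl, hx⟩
    refine ⟨f q, ?_, by dsimp only; rw [he, hq]⟩
    rw [Set.mem_ofPred_eq, hnorm]
    have := (point_eq_iff.1 (congrArg Subtype.val hq)).1
    rw [← this, cornerRadius_coneCoord _ _ _ q.2.2.2.1] at hR
    exact hR

theorem exists_disk [Finite V] (T : ColoredFlips V) (k : Fin 3) (v : V) :
    ∃ D : Metric.closedBall (0 : EuclideanSpace ℝ (Fin 2)) (3 / 2) → T.Surface,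
      Topology.IsEmbedding D ∧
      ∀ R : Set ℝ, D '' {p | ‖(p : EuclideanSpace ℝ (Fin 2))‖ ∈ R} =
        T.region k v {x | 1 / 2 ≤ x.1 k ∧ cornerRadius k x.1 ∈ R} := by
  obtain ⟨D, hD, h⟩ := T.exists_disk_complex k v
  let L := Complex.orthonormalBasisOneI.repr.symm
  let e : Metric.closedBall (0 : EuclideanSpace ℝ (Fin 2)) (3 / 2) ≃ₜ
      Metric.closedBall (0 : ℂ) (3 / 2) :=
    L.toHomeomorph.subtype fun x => by
      rw [mem_closedBall_zero_iff, mem_closedBall_zero_iff]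
      exact (congrArg (· ≤ (3 / 2 : ℝ)) (L.norm_map x)).symm ▸ Iff.rfl
  refine ⟨D ∘ e, hD.comp e.isEmbedding, fun R => ?_⟩
  rw [← h R, image_comp]
  congr 1
  apply Subset.antisymm
  · rintro _ ⟨p, hp, rfl⟩
    have : ‖((e p : Metric.closedBall (0 : ℂ) (3 / 2)) : ℂ)‖ = ‖(p : EuclideanSpace ℝ (Fin 2))‖ :=
      L.norm_map _
    rw [Set.mem_ofPred_eq, this]
    exact hp
  · intro q hq
    refine ⟨e.symm q, ?_, e.apply_symm_apply q⟩
    have : ‖((e (e.symm q) : Metric.closedBall (0 : ℂ) (3 / 2)) : ℂ)‖ =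
      ‖((e.symm q : Metric.closedBall (0 : EuclideanSpace ℝ (Fin 2)) (3 / 2)) :
        EuclideanSpace ℝ (Fin 2))‖ := L.norm_map _
    rw [Set.mem_ofPred_eq, ← this, e.apply_symm_apply]
    exact hq

end ColoredFlips

/-! ### Radii 1 and 3/2 in terms of coordinates. -/

theorem cubeCap_le_one (x : cubeCap) (i : Fin 3) : x.1 i ≤ 1 := (x.2.1 i).2

theorem cubeCap_eq_one {k : Fin 3} {x : cubeCap} (h : ∀ l, l ≠ k → x.1 l < 1) : x.1 k = 1 := by
  obtain ⟨j, hj⟩ := x.2.2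
  by_cases hjk : j = k
  · rwa [← hjk]
  · exact absurd hj (h j hjk).ne

theorem forall_ne_fin_three {k : Fin 3} {p : Fin 3 → Prop} :
    (∀ l, l ≠ k → p l) ↔ p (k + 1) ∧ p (k + 2) := by
  constructor
  · intro h
    exact ⟨h _ (by fin_cases k <;> simp), h _ (by fin_cases k <;> simp)⟩
  · rintro ⟨h1, h2⟩ l hl
    have : l = k + 1 ∨ l = k + 2 := by lia
    rcases this with rfl | rfl <;> assumption

theorem exists_ne_fin_three {k : Fin 3} {p : Fin 3 → Prop} :
    (∃ l, l ≠ k ∧ p l) ↔ p (k + 1) ∨ p (k + 2) := by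
  have := forall_ne_fin_three (k := k) (p := fun l => ¬ p l)
  rw [← not_iff_not]
  push Not
  exact this

/-- Either all coordinates but one are `1`, or all coordinates but one are less than `1`. -/
theorem not_exists_forall_ne_eq_one_iff (x : cubeCap) :
    (¬ ∃ i, ∀ l, l ≠ i → x.1 l = 1) ↔ ∃ k, ∀ l, l ≠ k → x.1 l < 1 := by
  constructor
  · intro h
    obtain ⟨k, hk⟩ := x.2.2
    refine ⟨k, fun l hl => lt_of_le_of_ne (cubeCap_le_one x l) fun hl1 => ?_⟩
    have key : ∀ k l : Fin 3, l ≠ k → ∃ i, ∀ j, j ≠ i → j = k ∨ j = l := by decide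
    obtain ⟨i, hi⟩ := key k l hl
    refine h ⟨i, fun j hj => ?_⟩
    rcases hi j hj with rfl | rfl <;> assumption
  · rintro ⟨k, hk⟩ ⟨i, hi⟩
    have key : ∀ k i : Fin 3, ∃ l, l ≠ k ∧ l ≠ i := by decide
    obtain ⟨l, hlk, hli⟩ := key k i
    exact (hk l hlk).ne (hi l hli)

/-- Both summands of the radius are nonnegative. Conversely, if the other coordinates are below 1,
then `x k = 1`, so the bound 1/2 is automatic. -/
theorem cornerRadius_lt_one_iff {k : Fin 3} {x : cubeCap} :
    1 / 2 ≤ x.1 k ∧ cornerRadius k x.1 ∈ Iio 1 ↔ ∀ l, l ≠ k → x.1 l < 1 := by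
  simp only [cornerRadius, mem_Iio]
  constructor
  · rintro ⟨-, h⟩
    have hk := cubeCap_le_one x k
    refine forall_ne_fin_three.2 ⟨?_, ?_⟩
    · linarith [le_max_left (x.1 (k + 1)) (x.1 (k + 2))]
    · linarith [le_max_right (x.1 (k + 1)) (x.1 (k + 2))]
  · intro h
    rw [cubeCap_eq_one h]
    refine ⟨by norm_num, ?_⟩
    have := forall_ne_fin_three.1 h
    linarith [max_lt this.1 this.2]

/-- Radius 1 says that `x k` equals the larger of the other two coordinates; that common value is
the maximum of all three, hence 1. -/
theorem cornerRadius_eq_one_iff {k : Fin 3} {x : cubeCap} :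
    1 / 2 ≤ x.1 k ∧ cornerRadius k x.1 ∈ ({1} : Set ℝ) ↔
      x.1 k = 1 ∧ ∃ l, l ≠ k ∧ x.1 l = 1 := by
  rw [exists_ne_fin_three, mem_singleton_iff, cornerRadius]
  have h1 := cubeCap_le_one x (k + 1)
  have h2 := cubeCap_le_one x (k + 2)
  constructor
  · rintro ⟨-, h⟩
    have hm : max (x.1 (k + 1)) (x.1 (k + 2)) = x.1 k := by linarith
    have hk : x.1 k = 1 := by
      by_contra hk
      have hk := lt_of_le_of_ne (cubeCap_le_one x k) hk
      rw [← hm] at hk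
      exact hk.ne (hm.trans (cubeCap_eq_one
        (forall_ne_fin_three.2 ⟨(le_max_left _ _).trans_lt hk, (le_max_right _ _).trans_lt hk⟩)))
    refine ⟨hk, ?_⟩
    rw [hk] at hm
    rcases max_choice (x.1 (k + 1)) (x.1 (k + 2)) with h' | h'
    · exact .inl (h'.symm.trans hm)
    · exact .inr (h'.symm.trans hm)
  · rintro ⟨hk, h | h⟩
    · refine ⟨by rw [hk]; norm_num, ?_⟩
      rw [h, hk, max_eq_left h2]; ring
    · refine ⟨by rw [hk]; norm_num, ?_⟩
      rw [h, hk, max_eq_right h1]; ring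

theorem cornerRadius_lt_three_halves_iff {k : Fin 3} {x : cubeCap} :
    1 / 2 ≤ x.1 k ∧ cornerRadius k x.1 ∈ Iio (3 / 2) ↔ 1 / 2 < x.1 k := by
  rw [mem_Iio, cornerRadius]
  have h1 := cubeCap_le_one x (k + 1)
  have h2 := cubeCap_le_one x (k + 2)
  constructor
  · rintro ⟨h, h'⟩
    refine lt_of_le_of_ne h fun he => ?_
    rw [← he] at h'
    have := cubeCap_eq_one (k := k) (x := x) (forall_ne_fin_three.2
      ⟨by linarith [le_max_left (x.1 (k + 1)) (x.1 (k + 2))],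
        by linarith [le_max_right (x.1 (k + 1)) (x.1 (k + 2))]⟩)
    linarith
  · intro h
    exact ⟨h.le, by linarith [max_le h1 h2]⟩

/-- The corner `k` of a triangle. -/
noncomputable def cubeCapCorner (k : Fin 3) : cubeCap :=
  ⟨fun l => if l = k then 1 else 0, fun l => by dsimp only; split_ifs <;> simp, k, if_pos rfl⟩

theorem cubeCapCorner_lt {k l : Fin 3} (h : l ≠ k) : (cubeCapCorner k).1 l < 1 := by
  simp [cubeCapCorner, h]

/-- The points of a triangle on the segment from the center to the midpoint of side `i`. -/
noncomputable def edgePoint (i : Fin 3) (t : unitInterval) : cubeCap :=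
  ⟨fun l => if l = i then |1 - 2 * (t : ℝ)| else 1, fun l => by
    have := t.2.1
    have := t.2.2
    dsimp only
    split_ifs
    · exact ⟨abs_nonneg _, abs_le.2 ⟨by linarith, by linarith⟩⟩
    · simp, i + 1, if_neg (by fin_cases i <;> simp)⟩

theorem edgePoint_self (i : Fin 3) (t : unitInterval) : (edgePoint i t).1 i = |1 - 2 * (t : ℝ)| :=
  if_pos rfl

theorem edgePoint_ne {i l : Fin 3} (h : l ≠ i) (t : unitInterval) : (edgePoint i t).1 l = 1 :=
  if_neg h

theorem edgePoint_lt (i : Fin 3) {t : unitInterval} (ht : t ∈ Ioo (0 : unitInterval) 1) :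
    (edgePoint i t).1 i < 1 := by
  have h0 : (0 : ℝ) < t := ht.1
  have h1 : (t : ℝ) < 1 := ht.2
  rw [edgePoint_self]
  exact abs_lt.2 ⟨by linarith, by linarith⟩

theorem continuous_edgePoint (i : Fin 3) : Continuous (edgePoint i) := by
  refine Continuous.subtype_mk (continuous_pi fun l => ?_) _
  split_ifs <;> fun_prop

/-! ### Open and closed faces, components and charts. -/

namespace ColoredFlips

variable {V : Type u} {T : ColoredFlips V} {k : Fin 3}

theorem region_congr {v : V} {A B : Set cubeCap} (h : ∀ x, x ∈ A ↔ x ∈ B) :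
    T.region k v A = T.region k v B := by
  rw [ext h]

/-- The open face around a corner. -/
def face (T : ColoredFlips V) (k : Fin 3) (v : V) : Set T.Surface :=
  T.region k v {x | ∀ l, l ≠ k → x.1 l < 1}

/-- The closed face around a corner. -/
def closedFace (T : ColoredFlips V) (k : Fin 3) (v : V) : Set T.Surface :=
  T.region k v {x | x.1 k = 1}

theorem point_mem_face {v w : V} {x : cubeCap} :
    T.point w x ∈ T.face k v ↔ T.Linked {k}ᶜ v w ∧ ∀ l, l ≠ k → x.1 l < 1 :=
  point_mem_region fun x hx => by rw [cubeCap_eq_one hx]; exact one_ne_zero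

theorem point_mem_closedFace {v w : V} {x : cubeCap} :
    T.point w x ∈ T.closedFace k v ↔ T.Linked {k}ᶜ v w ∧ x.1 k = 1 :=
  point_mem_region fun x (hx : x.1 k = 1) => by rw [hx]; exact one_ne_zero

theorem isOpen_face (v : V) : IsOpen (T.face k v) := by
  refine isOpen_region (fun x hx => by rw [cubeCap_eq_one hx]; exact one_ne_zero) ?_
  simp only [forall_ne_fin_three]
  exact (isOpen_lt (continuous_cubeCap_apply _) continuous_const).inter
    (isOpen_lt (continuous_cubeCap_apply _) continuous_const)

theorem isClosed_closedFace (v : V) : IsClosed (T.closedFace k v) :=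
  isClosed_region (fun x (hx : x.1 k = 1) => by rw [hx]; exact one_ne_zero)
    (isClosed_eq (continuous_cubeCap_apply _) continuous_const)

theorem face_subset_closedFace (v : V) : T.face k v ⊆ T.closedFace k v :=
  region_mono fun _ hx => cubeCap_eq_one hx

theorem closure_face (v : V) : closure (T.face k v) = T.closedFace k v := by
  refine (closure_minimal (face_subset_closedFace v) (isClosed_closedFace v)).antisymm ?_
  rintro _ ⟨w, x, rfl, hl, hx⟩
  -- Scaling the coordinates other than `k` by `t < 1` moves a point of the closed face into the
  -- open face.
  let f : unitInterval → cubeCap := fun t => ⟨fun l => if l = k then 1 else t * x.1 l, fun l => by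
    have := x.2.1 l
    dsimp only
    split_ifs
    · simp
    · exact ⟨mul_nonneg t.2.1 this.1, mul_le_one₀ t.2.2 this.1 this.2⟩, k, if_pos rfl⟩
  have hf : Continuous f := by
    refine Continuous.subtype_mk (continuous_pi fun l => ?_) _
    split_ifs <;> fun_prop
  have hf1 : f 1 = x := by
    refine Subtype.ext (funext fun l => ?_)
    by_cases h : l = k
    · subst h; exact (if_pos rfl).trans (Eq.symm hx)
    · exact (if_neg h).trans (one_mul _)
  have h1 : (1 : unitInterval) ∈ closure (Iio 1) := by
    rw [closure_Iio' ⟨(0 : unitInterval), zero_lt_one (α := unitInterval)⟩]; exact self_mem_Iic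
  have := map_mem_closure (t := T.face k v) ((continuous_point w).comp hf) h1 fun t ht =>
    point_mem_face.2 ⟨hl, fun l h => by
      have ht : (t : ℝ) < 1 := ht
      have h0 : (0 : ℝ) ≤ t := t.2.1
      have := x.2.1 l
      have e : (f t).1 l = t * x.1 l := if_neg h
      rw [e]
      nlinarith⟩
  rwa [Function.comp_apply, hf1] at this

section Finite

variable [Finite V]

theorem boundsDisk_face (v : V) :
    BoundsDisk (T.face k v) (T.region k v {x | x.1 k = 1 ∧ ∃ l, l ≠ k ∧ x.1 l = 1}) := by
  obtain ⟨D, hD, h⟩ := T.exists_disk k v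
  have hsub : Metric.closedBall (0 : EuclideanSpace ℝ (Fin 2)) 1 ⊆ Metric.closedBall 0 (3 / 2) :=
    Metric.closedBall_subset_closedBall (by norm_num)
  have key : ∀ R : Set ℝ, R ⊆ Iic 1 → (D ∘ inclusion hsub) '' {p | ‖p.1‖ ∈ R} =
      T.region k v {x | 1 / 2 ≤ x.1 k ∧ cornerRadius k x.1 ∈ R} := by
    intro R hR
    rw [image_comp, ← h R]
    congr 1
    apply Subset.antisymm
    · rintro _ ⟨p, hp, rfl⟩
      exact hp
    · intro p hp
      exact ⟨⟨p.1, mem_closedBall_zero_iff.2 (hR hp)⟩, hp, rfl⟩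
  refine ⟨D ∘ inclusion hsub, hD.comp (Topology.IsEmbedding.inclusion hsub), ?_, ?_⟩
  · exact (key (Iio 1) Iio_subset_Iic_self).trans
      (region_congr fun _ => cornerRadius_lt_one_iff)
  · exact (key {1} (by simp)).trans (region_congr fun _ => cornerRadius_eq_one_iff)

theorem isPreconnected_face (v : V) : IsPreconnected (T.face k v) := by
  obtain ⟨D, hD, h⟩ := T.exists_disk k v
  have : T.face k v = D '' {p | ‖(p : EuclideanSpace ℝ (Fin 2))‖ ∈ Iio 1} :=
    (region_congr fun _ => cornerRadius_lt_one_iff.symm).trans (h (Iio 1)).symm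
  rw [this]
  refine IsPreconnected.image ?_ D hD.continuous.continuousOn
  refine (Topology.IsInducing.subtypeVal.isPreconnected_image).1 ?_
  have : (Subtype.val '' {p : Metric.closedBall (0 : EuclideanSpace ℝ (Fin 2)) (3 / 2) |
      ‖(p : EuclideanSpace ℝ (Fin 2))‖ ∈ Iio 1}) = Metric.ball 0 1 := by
    ext p
    constructor
    · rintro ⟨q, hq, rfl⟩
      exact mem_ball_zero_iff.2 hq
    · intro hp
      have hp := mem_ball_zero_iff.1 hp
      exact ⟨⟨p, mem_closedBall_zero_iff.2 (by linarith)⟩, hp, rfl⟩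
  rw [this]
  exact (convex_ball _ _).isPreconnected

/-- Off the drawing exactly one coordinate is 1, so the open face and the closed face agree there.
The face is thus open and closed in the complement of `C`, and it is connected as the image of a
disk. -/
theorem connectedComponentIn_eq_face {C : Set T.Surface}
    (hC : ∀ w x, T.point w x ∈ C ↔ ∃ i, ∀ l, l ≠ i → x.1 l = 1) {v : V} {p : T.Surface}
    (hp : p ∈ T.face k v) : connectedComponentIn Cᶜ p = T.face k v := by
  have hsub : T.face k v ⊆ Cᶜ := by
    rintro _ ⟨w, x, rfl, -, hx⟩
    rw [mem_compl_iff, hC, not_exists_forall_ne_eq_one_iff]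
    exact ⟨k, hx⟩
  refine Subset.antisymm ?_ ((isPreconnected_face v).subset_connectedComponentIn hp hsub)
  refine isPreconnected_connectedComponentIn.subset_left_of_subset_union (isOpen_face v)
    (isClosed_closedFace (T := T) (k := k) v).isOpen_compl
    (disjoint_compl_right.mono_left (face_subset_closedFace v)) (fun q hq => ?_)
    ⟨p, mem_connectedComponentIn (hsub hp), hp⟩
  have hq := connectedComponentIn_subset _ _ hq
  by_cases hqk : q ∈ T.closedFace k v
  · left
    obtain ⟨w, x, rfl, hl, hx⟩ := hqk
    rw [mem_compl_iff, hC, not_exists_forall_ne_eq_one_iff] at hq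
    obtain ⟨j, hj⟩ := hq
    have : k = j := by
      by_contra h
      exact (hj k h).ne hx
    subst this
    exact point_mem_face.2 ⟨hl, hj⟩
  · exact .inr hqk

theorem exists_chart (p : T.Surface) :
    ∃ e : OpenPartialHomeomorph T.Surface (EuclideanSpace ℝ (Fin 2)), p ∈ e.source := by
  obtain ⟨v, x, rfl⟩ := exists_point p
  -- A corner whose coordinate is 1 at `x` works: its open disk of radius 3/2 is the region where
  -- coordinate `k` exceeds 1/2.
  obtain ⟨k, hk⟩ := x.2.2
  obtain ⟨D, hD, h⟩ := T.exists_disk k v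
  have hsub : Metric.ball (0 : EuclideanSpace ℝ (Fin 2)) (3 / 2) ⊆ Metric.closedBall 0 (3 / 2) :=
    Metric.ball_subset_closedBall
  have hrange : range (D ∘ inclusion hsub) = T.region k v {x | 1 / 2 < x.1 k} := by
    rw [range_comp]
    refine Eq.trans ?_ ((h (Iio (3 / 2))).trans
      (region_congr fun _ => cornerRadius_lt_three_halves_iff))
    congr 1
    apply Subset.antisymm
    · rintro _ ⟨p, rfl⟩
      exact mem_ball_zero_iff.1 p.2
    · intro p hp
      exact ⟨⟨p.1, mem_ball_zero_iff.2 hp⟩, rfl⟩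
  have hemb : Topology.IsOpenEmbedding (D ∘ inclusion hsub) := by
    refine ⟨hD.comp (Topology.IsEmbedding.inclusion hsub), ?_⟩
    rw [hrange]
    refine isOpen_region (fun x (hx : 1 / 2 < x.1 k) => ?_)
      (isOpen_lt continuous_const (continuous_cubeCap_apply k))
    exact (lt_trans (by norm_num) hx).ne'
  let U : TopologicalSpace.Opens (EuclideanSpace ℝ (Fin 2)) :=
    ⟨Metric.ball 0 (3 / 2), Metric.isOpen_ball⟩
  have hU : Nonempty U := ⟨⟨0, Metric.mem_ball_self (by norm_num)⟩⟩
  have hU' : Nonempty (Metric.ball (0 : EuclideanSpace ℝ (Fin 2)) (3 / 2)) := hU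
  refine ⟨(hemb.toOpenPartialHomeomorph _).symm.trans (U.openPartialHomeomorphSubtypeCoe hU), ?_⟩
  have : T.point v x ∈ range (D ∘ inclusion hsub) := by
    rw [hrange]
    refine ⟨v, x, rfl, .refl v, ?_⟩
    change _ < x.1 k
    rw [hk]; norm_num
  simpa using this

/-- The charts around the corners make the surface a two-manifold. -/
noncomputable instance : ChartedSpace (EuclideanSpace ℝ (Fin 2)) T.Surface where
  atlas := range fun p => (exists_chart (T := T) p).choose
  chartAt p := (exists_chart p).choose
  mem_chart_source p := (exists_chart p).choose_spec
  chart_mem_atlas p := ⟨p, rfl⟩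

end Finite

/-! ### The arcs of the drawing. -/

variable (T) in
/-- The arc that joins the centers of the triangles of `v` and `T.flip i v`. -/
noncomputable def arc (i : Fin 3) (v : V) : C(unitInterval, T.Surface) where
  toFun t := T.point (if (t : ℝ) ≤ 1 / 2 then v else T.flip i v) (edgePoint i t)
  continuous_toFun := by
    have : (fun t : unitInterval =>
        T.point (if (t : ℝ) ≤ 1 / 2 then v else T.flip i v) (edgePoint i t)) = fun t : unitInterval =>
        if (t : ℝ) ≤ 1 / 2 then T.point v (edgePoint i t)
          else T.point (T.flip i v) (edgePoint i t) := by
      funext t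
      split_ifs <;> rfl
    rw [this]
    refine Continuous.if_le ((continuous_point _).comp (continuous_edgePoint i))
      ((continuous_point _).comp (continuous_edgePoint i)) continuous_subtype_val
      continuous_const fun t ht => (point_flip ?_ v).symm
    rw [edgePoint_self, ht]
    norm_num

theorem arc_apply (i : Fin 3) (v : V) (t : unitInterval) :
    T.arc i v t = T.point (if (t : ℝ) ≤ 1 / 2 then v else T.flip i v) (edgePoint i t) := rfl

theorem edgePoint_zero (i : Fin 3) : edgePoint i 0 = ⟨1, one_mem_cubeCap⟩ := by
  refine Subtype.ext (funext fun l => ?_)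
  by_cases h : l = i
  · subst h; rw [edgePoint_self]; simp
  · exact edgePoint_ne h _

theorem edgePoint_one (i : Fin 3) : edgePoint i 1 = ⟨1, one_mem_cubeCap⟩ := by
  refine Subtype.ext (funext fun l => ?_)
  by_cases h : l = i
  · subst h; rw [edgePoint_self]; norm_num
  · exact edgePoint_ne h _

theorem arc_zero (i : Fin 3) (v : V) : T.arc i v 0 = T.point v ⟨1, one_mem_cubeCap⟩ := by
  rw [arc_apply, edgePoint_zero, if_pos (by simp)]

theorem arc_one (i : Fin 3) (v : V) :
    T.arc i v 1 = T.point (T.flip i v) ⟨1, one_mem_cubeCap⟩ := by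
  rw [arc_apply, edgePoint_one, if_neg (by norm_num)]

/-- The coordinate `|1 - 2 * t|` determines `t` up to reflection at 1/2. Distinct reflected
parameters give points with no zero coordinate, which lie in one triangle only, while the two halves
of the arc lie in different triangles. -/
theorem arc_injective (i : Fin 3) (v : V) : Function.Injective (T.arc i v) := by
  intro t t' h
  rw [arc_apply, arc_apply, point_eq_iff] at h
  obtain ⟨hx, hl⟩ := h
  have habs := congrFun (congrArg Subtype.val hx) i
  rw [edgePoint_self, edgePoint_self] at habs
  refine Subtype.ext ?_
  rcases abs_eq_abs.1 habs with h | h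
  · linarith
  · by_contra hne
    have hI : {l | (edgePoint i t).1 l = 0} = ∅ := by
      refine eq_empty_of_forall_notMem fun l (hl : (edgePoint i t).1 l = 0) => ?_
      by_cases hli : l = i
      · subst hli
        rw [edgePoint_self, abs_eq_zero] at hl
        exact hne (by linarith)
      · rw [edgePoint_ne hli] at hl
        exact one_ne_zero hl
    have := hl.eq hI
    split_ifs at this with h1 h2 h2
    · exact hne (by linarith)
    · exact T.flip_ne _ _ this.symm
    · exact T.flip_ne _ _ this
    · exact hne (by linarith)

theorem arc_ne_center {i : Fin 3} (v w : V) {t : unitInterval}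
    (ht : t ∈ Ioo (0 : unitInterval) 1) : T.arc i v t ≠ T.point w ⟨1, one_mem_cubeCap⟩ := by
  intro h
  have := congrFun (congrArg Subtype.val (point_eq_iff.1 h).1) i
  exact (edgePoint_lt i ht).ne this

theorem point_mem_range_arc {i : Fin 3} {v w : V} {x : cubeCap} :
    T.point w x ∈ range (T.arc i v) ↔ (w = v ∨ w = T.flip i v) ∧ ∀ l, l ≠ i → x.1 l = 1 := by
  constructor
  · rintro ⟨t, ht⟩
    rw [arc_apply, point_eq_iff] at ht
    obtain ⟨rfl, hl⟩ := ht
    refine ⟨?_, fun l hl => edgePoint_ne hl t⟩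
    have h := hl.eq_or_eq_flip (i := i) fun l (hl : (edgePoint i t).1 l = 0) => by
      by_contra h
      rw [edgePoint_ne h] at hl
      exact one_ne_zero hl
    split_ifs at h
    · exact h.imp_right And.right
    · rw [T.flip_flip] at h
      exact (h.imp_right And.right).symm
  · rintro ⟨hw, hx⟩
    have h01 := x.2.1 i
    have hpt : ∀ t : unitInterval, |1 - 2 * (t : ℝ)| = x.1 i → edgePoint i t = x := by
      intro t ht
      refine Subtype.ext (funext fun l => ?_)
      by_cases h : l = i
      · subst h; rw [edgePoint_self, ht]
      · rw [edgePoint_ne h, hx l h]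
    rcases hw with rfl | rfl
    · refine ⟨⟨(1 - x.1 i) / 2, by linarith, by linarith⟩, ?_⟩
      rw [arc_apply, if_pos (by dsimp only; linarith), hpt]
      dsimp only
      rw [show 1 - 2 * ((1 - x.1 i) / 2) = x.1 i by ring, abs_of_nonneg h01.1]
    · have he : edgePoint i ⟨(1 + x.1 i) / 2, by linarith, by linarith⟩ = x := by
        apply hpt
        dsimp only
        rw [show 1 - 2 * ((1 + x.1 i) / 2) = -x.1 i by ring, abs_neg, abs_of_nonneg h01.1]
      refine ⟨⟨(1 + x.1 i) / 2, by linarith, by linarith⟩, ?_⟩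
      rw [arc_apply, he]
      split_ifs with h
      · dsimp only at h
        exact (point_flip (by linarith) v).symm
      · rfl

/-- At an interior point of an arc only one coordinate is below 1, and its index is the color; the
triangle then reveals an end of the edge. -/
theorem arc_eq_arc {i j : Fin 3} {v w : V} {t t' : unitInterval}
    (ht : t ∈ Ioo (0 : unitInterval) 1) (h : T.arc i v t = T.arc j w t') :
    j = i ∧ (w = v ∨ w = T.flip i v) := by
  have hm : T.arc j w t' ∈ range (T.arc i v) := ⟨t, h⟩
  rw [arc_apply, arc_apply] at h
  have hx := (point_eq_iff.1 h).1
  have hij : j = i := by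
    by_contra hij
    have := edgePoint_lt i ht
    rw [hx, edgePoint_ne (Ne.symm hij)] at this
    exact lt_irrefl _ this
  subst hij
  refine ⟨rfl, ?_⟩
  rw [arc_apply, point_mem_range_arc] at hm
  have h1 := hm.1
  split_ifs at h1
  · exact h1
  · rcases h1 with h1 | h1
    · exact .inr (by rw [← h1, T.flip_flip])
    · exact .inl (by rw [← T.flip_flip j w, h1, T.flip_flip])

end ColoredFlips

/-! ### Cycles in the graph from periodic sequences. -/

section Cycles

variable {V : Type u} {G : SimpleGraph V}

theorem exists_walk_of_adj_succ {s : ℤ → V} (hs : ∀ a, G.Adj (s a) (s (a + 1))) (m : ℕ) :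
    ∃ p : G.Walk (s 0) (s m), p.support = (List.range (m + 1)).map (fun a : ℕ => s a) ∧
      p.edges = (List.range m).map fun a : ℕ => s(s a, s (a + 1)) := by
  induction m with
  | zero => exact ⟨.nil, by simp, by simp⟩
  | succ m ih =>
    obtain ⟨p, hp, hp'⟩ := ih
    refine ⟨(p.concat (hs m)).copy rfl (by push_cast; rfl), ?_, ?_⟩
    · rw [SimpleGraph.Walk.support_copy, SimpleGraph.Walk.support_concat, hp,
        List.range_succ (n := m + 1)]
      simp
    · rw [SimpleGraph.Walk.edges_copy, SimpleGraph.Walk.edges_concat, hp', List.range_succ (n := m)]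
      simp

theorem exists_isCycle_of_period {s : ℤ → V} (hs : ∀ a, G.Adj (s a) (s (a + 1))) {n : ℕ}
    (hn : 2 < n) (hp : ∀ a b, s a = s b ↔ (n : ℤ) ∣ a - b) :
    ∃ (v : V) (p : G.Walk v v), p.IsCycle ∧ (∀ w, w ∈ p.support ↔ ∃ a, s a = w) ∧
      ∀ e, e ∈ p.edges ↔ ∃ a, s(s a, s (a + 1)) = e := by
  obtain ⟨m, rfl⟩ : ∃ m, n = m + 1 := ⟨n - 1, by lia⟩
  have hinj : ∀ {a b : ℕ}, a ≤ m → b ≤ m → s a = s b → a = b := by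
    intro a b ha hb hab
    have := Int.eq_zero_of_abs_lt_dvd ((hp a b).1 hab) (by rw [abs_lt]; lia)
    lia
  have hperiod : s (m + 1) = s 0 := (hp _ _).2 (by simp)
  have hmod : ∀ a : ℤ, ∃ b : ℕ, b ≤ m ∧ s a = s b ∧ s (a + 1) = s (b + 1) := by
    intro a
    have h1 := Int.emod_nonneg a (b := (m + 1 : ℕ)) (by lia)
    have h2 := Int.emod_lt_of_pos a (b := (m + 1 : ℕ)) (by lia)
    have h3 : ((m + 1 : ℕ) : ℤ) ∣ a - a % (m + 1 : ℕ) := Int.dvd_self_sub_emod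
    refine ⟨(a % (m + 1 : ℕ)).toNat, by lia, (hp _ _).2 ?_, (hp _ _).2 ?_⟩
    · rwa [Int.toNat_of_nonneg h1]
    · rwa [Int.toNat_of_nonneg h1, add_sub_add_right_eq_sub]
  obtain ⟨p, hsup, hedges⟩ := exists_walk_of_adj_succ hs m
  have hadj : G.Adj (s m) (s 0) := hperiod ▸ hs m
  -- One period is a path from `s 0` to `s m`, closed by the edge back to `s 0`. This edge is not on
  -- the path since that would force `m = 1`, against `n > 2`.
  refine ⟨s m, .cons hadj p, ?_, ?_, ?_⟩
  · rw [SimpleGraph.Walk.cons_isCycle_iff, SimpleGraph.Walk.isPath_def, hsup, hedges]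
    constructor
    · refine List.Nodup.map_on (fun a ha b hb hab => hinj ?_ ?_ hab) List.nodup_range
      · rw [List.mem_range] at ha; lia
      · rw [List.mem_range] at hb; lia
    · rw [List.mem_map]
      rintro ⟨a, ha, hae⟩
      rw [List.mem_range] at ha
      rcases Sym2.eq_iff.1 hae with ⟨h, -⟩ | ⟨h, h'⟩
      · have := hinj ha.le le_rfl h
        lia
      · have h1 := hinj (b := 0) ha.le (Nat.zero_le _) (by simpa using h)
        have h2 := hinj (a := a + 1) (b := m) (by lia) le_rfl (by simpa using h')
        lia
  · intro w
    rw [SimpleGraph.Walk.support_cons, hsup, List.mem_cons, List.mem_map]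
    constructor
    · rintro (rfl | ⟨a, -, rfl⟩) <;> exact ⟨_, rfl⟩
    · rintro ⟨a, rfl⟩
      obtain ⟨b, hb, hab, -⟩ := hmod a
      exact .inr ⟨b, List.mem_range.2 (by lia), hab.symm⟩
  · intro e
    rw [SimpleGraph.Walk.edges_cons, hedges, List.mem_cons, List.mem_map]
    constructor
    · rintro (rfl | ⟨a, -, rfl⟩)
      · exact ⟨m, by rw [hperiod]⟩
      · exact ⟨a, rfl⟩
    · rintro ⟨a, rfl⟩
      obtain ⟨b, hb, hab, hab'⟩ := hmod a
      rw [hab, hab']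
      rcases hb.eq_or_lt with rfl | hb
      · exact .inl (by rw [hperiod])
      · exact .inr ⟨b, List.mem_range.2 hb, rfl⟩

end Cycles

/-! ### Components after deleting a color. -/

section ColoredGraph

variable {V : Type u} {G : SimpleGraph V} {c : G.lineGraph.Coloring (Fin 3)}

theorem exists_mem_edge (e : G.edgeSet) : ∃ v, v ∈ (e : Sym2 V) :=
  ⟨_, Sym2.out_fst_mem _⟩

namespace TwoColoredCycle

/-- The cycle through a vertex that avoids a color. -/
def through (c : G.lineGraph.Coloring (Fin 3)) (j : Fin 3) (v : V) : TwoColoredCycle c :=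
  ⟨j, (deleteColor c j).connectedComponentMk v⟩

theorem mem_vertices_through (j : Fin 3) (v : V) : v ∈ (through c j v).vertices := rfl

theorem exists_mem_vertices (K : TwoColoredCycle c) : ∃ v, v ∈ K.vertices := by
  obtain ⟨v, hv⟩ := K.2.exists_rep
  exact ⟨v, hv⟩

theorem eq_of_mem_vertices {K L : TwoColoredCycle c} {v : V} (h : K.color = L.color)
    (hK : v ∈ K.vertices) (hL : v ∈ L.vertices) : K = L := by
  obtain ⟨k, K⟩ := K
  obtain ⟨l, L⟩ := L
  obtain rfl : k = l := h
  have hK : (deleteColor c k).connectedComponentMk v = K := hK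
  have hL : (deleteColor c k).connectedComponentMk v = L := hL
  rw [← hK, ← hL]

/-- Some vertex of the cycle. -/
noncomputable def base (K : TwoColoredCycle c) : V := K.exists_mem_vertices.choose

theorem base_mem (K : TwoColoredCycle c) : K.base ∈ K.vertices := K.exists_mem_vertices.choose_spec

end TwoColoredCycle

end ColoredGraph

/-! ### The drawing and its faces. -/

section DrawnGraph

open ColoredFlips

variable {V : Type u} {G : SimpleGraph V} [G.LocallyFinite] (hreg : G.IsRegularOfDegree 3)
  (c : G.lineGraph.Coloring (Fin 3))

theorem edge_eq_of_mem {e : G.edgeSet} {v : V} (h : v ∈ (e : Sym2 V)) :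
    (e : Sym2 V) = s(v, (ofColoring hreg c).flip (c e) v) := by
  obtain ⟨hadj, hc⟩ := ofColoring_adj hreg c (c e) v
  exact congrArg Subtype.val (eq_of_color_eq_of_mem c hc.symm h (Sym2.mem_mk_left _ _))

theorem mem_edge_iff {e : G.edgeSet} {v w : V} (h : v ∈ (e : Sym2 V)) :
    w ∈ (e : Sym2 V) ↔ w = v ∨ w = (ofColoring hreg c).flip (c e) v := by
  rw [edge_eq_of_mem hreg c h, Sym2.mem_iff]

include hreg in
/-- There is an edge of each color at each vertex. -/
theorem exists_edge_at (i : Fin 3) (v : V) :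
    ∃ e : G.edgeSet, c e = i ∧ v ∈ (e : Sym2 V) := by
  obtain ⟨hadj, hc⟩ := ofColoring_adj hreg c i v
  exact ⟨_, hc, Sym2.mem_mk_left _ _⟩

variable {c}

namespace TwoColoredCycle

theorem linked_iff_mem_vertices {K : TwoColoredCycle c} {v w : V} (hv : v ∈ K.vertices) :
    (ofColoring hreg c).Linked {K.color}ᶜ v w ↔ w ∈ K.vertices := by
  have hv : (deleteColor c K.color).connectedComponentMk v = K.2 := hv
  change _ ↔ (deleteColor c K.color).connectedComponentMk w = K.2
  rw [← reachable_deleteColor_iff, ← hv, SimpleGraph.ConnectedComponent.eq,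
    SimpleGraph.reachable_comm]

include hreg in
-- One end suffices: the other is reached by a flip of a color other than that of `K`, which stays
-- in the component.
theorem mem_edges_iff {K : TwoColoredCycle c} {e : G.edgeSet} {v : V} (hv : v ∈ (e : Sym2 V)) :
    e ∈ K.edges ↔ c e ≠ K.color ∧ v ∈ K.vertices := by
  refine ⟨fun h => ⟨h.1, h.2 v hv⟩, fun ⟨hc, hvK⟩ => ⟨hc, fun w hw => ?_⟩⟩
  rcases (mem_edge_iff hreg c hv).1 hw with rfl | rfl
  · exact hvK
  · exact (linked_iff_mem_vertices hreg hvK).1 (linked_flip hc v)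

include hreg in
theorem isCycle [Finite V] (K : TwoColoredCycle c) : K.IsCycle := by
  obtain ⟨v, hv⟩ := K.exists_mem_vertices
  obtain ⟨s, hs, rfl⟩ := (ofColoring hreg c).exists_isAlternating K.color v
  obtain ⟨n, hn, -, hper⟩ := hs.exists_period
  have hadj : ∀ a, ∃ h : G.Adj (s a) (s (a + 1)),
      c ⟨s(s a, s (a + 1)), G.mem_edgeSet.2 h⟩ = altColor K.color a := by
    intro a
    rw [hs a]
    exact ofColoring_adj hreg c _ _
  obtain ⟨v, p, hp, hsup, hedges⟩ := exists_isCycle_of_period (fun a => (hadj a).choose) hn hper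
  have hmem : ∀ w, w ∈ K.vertices ↔ ∃ a, s a = w := fun w => by
    rw [← linked_iff_mem_vertices hreg hv, hs.linked_iff]
  refine ⟨v, p, hp, fun w => (hsup w).trans (hmem w).symm, fun e => (hedges e).trans ?_⟩
  constructor
  · rintro ⟨a, ha⟩
    have he : e = ⟨s(s a, s (a + 1)), G.mem_edgeSet.2 (hadj a).choose⟩ := Subtype.ext ha.symm
    have hc : c e = altColor K.color a := by rw [he]; exact (hadj a).choose_spec
    have hmem_e : s a ∈ (e : Sym2 V) := by rw [← ha]; exact Sym2.mem_mk_left _ _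
    exact (mem_edges_iff hreg hmem_e).2
      ⟨by rw [hc]; exact altColor_ne _ _, (hmem _).2 ⟨a, rfl⟩⟩
  · intro he
    obtain ⟨w, hw⟩ := exists_mem_edge e
    obtain ⟨a, rfl⟩ := (hmem w).1 (he.2 w hw)
    have hE := edge_eq_of_mem hreg c hw
    rcases eq_altColor_or K.color a (c e) with h | h | h
    · exact absurd h he.1
    · exact ⟨a, by rw [hE, h, ← hs a]⟩
    · refine ⟨a - 1, ?_⟩
      rw [hE, h, ← hs.sub_one, sub_add_cancel, Sym2.eq_swap]

end TwoColoredCycle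

variable (c)

/-- The graph drawn on the surface: vertices go to centers of triangles, edges to arcs that cross
the common side of two triangles. -/
noncomputable def surfaceEmbedding : GraphEmbedding G (ofColoring hreg c).Surface where
  vertex v := (ofColoring hreg c).point v ⟨1, one_mem_cubeCap⟩
  arc e := (ofColoring hreg c).arc (c e) (exists_mem_edge e).choose
  vertex_injective v w h := by
    refine ((point_eq_iff.1 h).2.eq ?_).symm
    exact eq_empty_of_forall_notMem fun i (hi : (1 : ℝ) = 0) => one_ne_zero hi
  arc_injective e := arc_injective _ _
  arc_ends e := by
    rw [arc_zero, arc_one]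
    conv_rhs => rw [edge_eq_of_mem hreg c (exists_mem_edge e).choose_spec]
    rfl
  vertex_notMem_interior e t w ht := arc_ne_center _ _ ht
  interior_disjoint e e' hne := by
    rw [Set.disjoint_left]
    rintro _ ⟨t, ht, rfl⟩ ⟨t', -, h⟩
    obtain ⟨hc, hw⟩ := arc_eq_arc ht h.symm
    refine hne (eq_of_color_eq_of_mem c hc.symm ?_ (exists_mem_edge e').choose_spec)
    exact (mem_edge_iff hreg c (exists_mem_edge e).choose_spec).2 hw

theorem point_mem_range_surfaceEmbedding_arc {e : G.edgeSet} {w : V} {x : cubeCap} :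
    (ofColoring hreg c).point w x ∈ range ((surfaceEmbedding hreg c).arc e) ↔
      w ∈ (e : Sym2 V) ∧ ∀ l, l ≠ c e → x.1 l = 1 :=
  point_mem_range_arc.trans
    (and_congr_left' (mem_edge_iff hreg c (exists_mem_edge e).choose_spec).symm)

theorem point_mem_edgeImage {F : Set G.edgeSet} {w : V} {x : cubeCap} :
    (ofColoring hreg c).point w x ∈ (surfaceEmbedding hreg c).edgeImage F ↔
      ∃ e ∈ F, w ∈ (e : Sym2 V) ∧ ∀ l, l ≠ c e → x.1 l = 1 := by
  simp only [GraphEmbedding.edgeImage, mem_iUnion, point_mem_range_surfaceEmbedding_arc,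
    exists_prop]

theorem point_mem_carrier (w : V) (x : cubeCap) :
    (ofColoring hreg c).point w x ∈ (surfaceEmbedding hreg c).carrier ↔
      ∃ i, ∀ l, l ≠ i → x.1 l = 1 := by
  rw [GraphEmbedding.carrier, mem_union, point_mem_edgeImage]
  constructor
  · rintro (⟨v, h⟩ | ⟨e, -, -, h⟩)
    · obtain ⟨rfl, -⟩ := point_eq_iff.1 h
      exact ⟨0, fun _ _ => rfl⟩
    · exact ⟨_, h⟩
  · rintro ⟨i, h⟩
    obtain ⟨e, rfl, hw⟩ := exists_edge_at hreg c i w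
    exact .inr ⟨e, mem_univ _, hw, h⟩

variable {c}

/-- The open face of a two-colored cycle. -/
def cycleFace (K : TwoColoredCycle c) : Set (ofColoring hreg c).Surface :=
  (ofColoring hreg c).face K.color K.base

theorem point_mem_cycleFace {K : TwoColoredCycle c} {w : V} {x : cubeCap} :
    (ofColoring hreg c).point w x ∈ cycleFace hreg K ↔
      w ∈ K.vertices ∧ ∀ l, l ≠ K.color → x.1 l < 1 :=
  point_mem_face.trans
    (and_congr_left' (TwoColoredCycle.linked_iff_mem_vertices hreg K.base_mem))

theorem point_mem_closure_cycleFace {K : TwoColoredCycle c} {w : V} {x : cubeCap} :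
    (ofColoring hreg c).point w x ∈ closure (cycleFace hreg K) ↔
      w ∈ K.vertices ∧ x.1 K.color = 1 := by
  rw [cycleFace, closure_face]
  exact point_mem_closedFace.trans
    (and_congr_left' (TwoColoredCycle.linked_iff_mem_vertices hreg K.base_mem))

theorem subset_frontier_cycleFace_iff {K : TwoColoredCycle c} {e : G.edgeSet} :
    range ((surfaceEmbedding hreg c).arc e) ⊆ frontier (cycleFace hreg K) ↔ e ∈ K.edges := by
  obtain ⟨v, hv⟩ := exists_mem_edge e
  rw [TwoColoredCycle.mem_edges_iff hreg hv]
  constructor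
  · intro h
    -- The midpoint of the arc has coordinate `c e` equal to 0, whereas points of the closed face
    -- have coordinate `K.color` equal to 1.
    obtain ⟨y, hy⟩ := exists_cubeCap_eq_zero (c e)
    have := point_mem_closure_cycleFace hreg |>.1 (frontier_subset_closure
      (h ((point_mem_range_surfaceEmbedding_arc hreg c).2 ⟨hv, hy.2⟩)))
    refine ⟨fun hc => ?_, this.1⟩
    have h1 := this.2
    rw [← hc, hy.1] at h1
    exact zero_ne_one h1
  · rintro ⟨hc, hvK⟩ p hp
    have hfr : frontier (cycleFace hreg K) = closure (cycleFace hreg K) \ cycleFace hreg K :=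
      (isOpen_face _).frontier_eq
    have heK := (TwoColoredCycle.mem_edges_iff hreg hv).2 ⟨hc, hvK⟩
    obtain ⟨w, x, rfl⟩ := exists_point p
    obtain ⟨hw, hx⟩ := (point_mem_range_surfaceEmbedding_arc hreg c).1 hp
    rw [hfr]
    refine ⟨(point_mem_closure_cycleFace hreg).2 ⟨heK.2 w hw, hx _ hc.symm⟩, fun h => ?_⟩
    exact (not_exists_forall_ne_eq_one_iff x).2 ⟨_, ((point_mem_cycleFace hreg).1 h).2⟩ ⟨_, hx⟩

theorem boundsDisk_cycleFace [Finite V] (K : TwoColoredCycle c) :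
    BoundsDisk (cycleFace hreg K) ((surfaceEmbedding hreg c).edgeImage K.edges) := by
  refine (congrArg (BoundsDisk (cycleFace hreg K)) (ext fun p => ?_)).mp (boundsDisk_face K.base)
  obtain ⟨w, x, rfl⟩ := exists_point p
  rw [point_mem_edgeImage, point_mem_region fun x hx => by rw [hx.1]; exact one_ne_zero,
    TwoColoredCycle.linked_iff_mem_vertices hreg K.base_mem]
  constructor
  · rintro ⟨hw, hk, l, hlk, hl⟩
    -- A point with coordinates `K.color` and `l` equal to 1 lies on the arc of the third color at
    -- `w`.
    obtain ⟨i, hik, hi⟩ : ∃ i : Fin 3, i ≠ K.color ∧ ∀ j, j ≠ i → j = K.color ∨ j = l := by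
      have key : ∀ k l : Fin 3, l ≠ k → ∃ i, i ≠ k ∧ ∀ j, j ≠ i → j = k ∨ j = l := by decide
      exact key _ _ hlk
    obtain ⟨e, rfl, he⟩ := exists_edge_at hreg c i w
    refine ⟨e, (TwoColoredCycle.mem_edges_iff hreg he).2 ⟨hik, hw⟩, he, fun j hj => ?_⟩
    rcases hi j hj with rfl | rfl <;> assumption
  · rintro ⟨e, he, hw, hx⟩
    refine ⟨he.2 w hw, hx _ he.1.symm, ?_⟩
    have key : ∀ k i : Fin 3, i ≠ k → ∃ l, l ≠ k ∧ l ≠ i := by decide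
    obtain ⟨l, hlk, hli⟩ := key _ _ he.1
    exact ⟨l, hlk, hx l hli⟩

theorem closure_cycleFace_inter {K L : TwoColoredCycle c} (hKL : K ≠ L) :
    closure (cycleFace hreg K) ∩ closure (cycleFace hreg L) =
      (surfaceEmbedding hreg c).edgeImage (K.edges ∩ L.edges) := by
  ext p
  obtain ⟨w, x, rfl⟩ := exists_point p
  rw [mem_inter_iff, point_mem_closure_cycleFace, point_mem_closure_cycleFace, point_mem_edgeImage]
  constructor
  · rintro ⟨⟨hwK, hxK⟩, hwL, hxL⟩
    -- Distinct cycles of one color share no vertex. With two colors, both coordinates are 1, so the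
    -- point is on the arc of the third color, whose edge belongs to both cycles.
    have hcol : K.color ≠ L.color := fun h =>
      hKL (TwoColoredCycle.eq_of_mem_vertices h hwK hwL)
    obtain ⟨i, hiK, hiL, hi⟩ : ∃ i : Fin 3, i ≠ K.color ∧ i ≠ L.color ∧
        ∀ j, j ≠ i → j = K.color ∨ j = L.color := by
      have key : ∀ k l : Fin 3, k ≠ l → ∃ i, i ≠ k ∧ i ≠ l ∧ ∀ j, j ≠ i → j = k ∨ j = l := by
        decide
      exact key _ _ hcol
    obtain ⟨e, rfl, he⟩ := exists_edge_at hreg c i w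
    refine ⟨e, ⟨(TwoColoredCycle.mem_edges_iff hreg he).2 ⟨hiK, hwK⟩,
      (TwoColoredCycle.mem_edges_iff hreg he).2 ⟨hiL, hwL⟩⟩, he, fun j hj => ?_⟩
    rcases hi j hj with rfl | rfl <;> assumption
  · rintro ⟨e, ⟨heK, heL⟩, hw, hx⟩
    exact ⟨⟨heK.2 w hw, hx _ heK.1.symm⟩, heL.2 w hw, hx _ heL.1.symm⟩

variable (c) in
/-- The faces of the drawing are the two-colored cycles. -/
noncomputable def cycleEquivFace [Finite V] :
    TwoColoredCycle c ≃ (surfaceEmbedding hreg c).Face :=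
  Equiv.ofBijective
    (fun K => ⟨cycleFace hreg K, (ofColoring hreg c).point K.base (cubeCapCorner K.color), by
      rw [mem_compl_iff, point_mem_carrier, not_exists_forall_ne_eq_one_iff]
      exact ⟨_, fun _ => cubeCapCorner_lt⟩, by
      refine (connectedComponentIn_eq_face (point_mem_carrier hreg c) ?_).symm
      exact point_mem_face.2 ⟨.refl _, fun _ => cubeCapCorner_lt⟩⟩) <| by
    constructor
    · intro K L h
      have h : cycleFace hreg K = cycleFace hreg L := congrArg Subtype.val h
      have hmem : (ofColoring hreg c).point K.base (cubeCapCorner K.color) ∈ cycleFace hreg K :=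
        (point_mem_cycleFace hreg).2 ⟨K.base_mem, fun _ => cubeCapCorner_lt⟩
      rw [h, point_mem_cycleFace] at hmem
      refine TwoColoredCycle.eq_of_mem_vertices ?_ K.base_mem hmem.1
      by_contra hne
      exact (hmem.2 _ hne).ne (if_pos rfl)
    · rintro ⟨A, p, hp, rfl⟩
      obtain ⟨w, x, rfl⟩ := exists_point p
      -- The only coordinate equal to 1 names the color, and the triangle containing the point picks
      -- the cycle.
      obtain ⟨k, hk⟩ := (not_exists_forall_ne_eq_one_iff x).1
        (mt (point_mem_carrier hreg c w x).2 hp)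
      refine ⟨.through c k w, Subtype.ext ?_⟩
      exact (connectedComponentIn_eq_face (point_mem_carrier hreg c)
        ((point_mem_cycleFace hreg (K := .through c k w)).2 ⟨rfl, hk⟩)).symm

theorem linked_univ (hconn : G.Connected) (v w : V) : (ofColoring hreg c).Linked univ v w := by
  have := (SimpleGraph.reachable_iff_reflTransGen v w).1 (hconn.preconnected v w)
  exact Relation.ReflTransGen.mono
    (fun a b hab => ⟨_, mem_univ _, ofColoring_flip_eq hreg c hab⟩) _ _ this

theorem onBoundary_cycleEquivFace_iff [Finite V] {K : TwoColoredCycle c} {e : G.edgeSet} :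
    (surfaceEmbedding hreg c).OnBoundary e (cycleEquivFace hreg c K) ↔ e ∈ K.edges :=
  subset_frontier_cycleFace_iff hreg

variable (c) in
/-- A face gets the color that its boundary cycle avoids. -/
noncomputable def faceColor [Finite V] (A : (surfaceEmbedding hreg c).Face) : Fin 3 :=
  ((cycleEquivFace hreg c).symm A).color

theorem faceColor_cycleEquivFace [Finite V] (K : TwoColoredCycle c) :
    faceColor hreg c (cycleEquivFace hreg c K) = K.color := by
  rw [faceColor, Equiv.symm_apply_apply]

theorem isProperFaceColoring_faceColor [Finite V] :
    (surfaceEmbedding hreg c).IsProperFaceColoring (faceColor hreg c) := by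
  intro e A B
  obtain ⟨K, rfl⟩ := (cycleEquivFace hreg c).surjective A
  obtain ⟨L, rfl⟩ := (cycleEquivFace hreg c).surjective B
  rw [onBoundary_cycleEquivFace_iff, onBoundary_cycleEquivFace_iff,
    faceColor_cycleEquivFace, faceColor_cycleEquivFace]
  intro hne hK hL hcol
  obtain ⟨v, hv⟩ := exists_mem_edge e
  exact hne (congrArg _ (TwoColoredCycle.eq_of_mem_vertices hcol (hK.2 v hv) (hL.2 v hv)))

theorem faceColor_ne_of_onBoundary [Finite V] {e : G.edgeSet} {A : (surfaceEmbedding hreg c).Face}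
    (h : (surfaceEmbedding hreg c).OnBoundary e A) : faceColor hreg c A ≠ c e := by
  obtain ⟨K, rfl⟩ := (cycleEquivFace hreg c).surjective A
  rw [onBoundary_cycleEquivFace_iff] at h
  rw [faceColor_cycleEquivFace]
  exact h.1.symm

theorem existsUnique_face_onBoundary [Finite V] {e : G.edgeSet} {j : Fin 3} (hj : j ≠ c e) :
    ∃! A, faceColor hreg c A = j ∧ (surfaceEmbedding hreg c).OnBoundary e A := by
  obtain ⟨v, hv⟩ := exists_mem_edge e
  refine ⟨cycleEquivFace hreg c (.through c j v), ⟨faceColor_cycleEquivFace _ _, ?_⟩, fun B => ?_⟩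
  · rw [onBoundary_cycleEquivFace_iff, TwoColoredCycle.mem_edges_iff hreg hv]
    exact ⟨hj.symm, TwoColoredCycle.mem_vertices_through j v⟩
  · obtain ⟨K, rfl⟩ := (cycleEquivFace hreg c).surjective B
    rintro ⟨hcol, hK⟩
    rw [onBoundary_cycleEquivFace_iff] at hK
    rw [faceColor_cycleEquivFace] at hcol
    exact congrArg _ (TwoColoredCycle.eq_of_mem_vertices hcol (hK.2 v hv)
      (TwoColoredCycle.mem_vertices_through j v))

end DrawnGraph

theorem lemma2 {V : Type u} [Finite V] (G : SimpleGraph V) [G.LocallyFinite]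
    (hconn : G.Connected) (hreg : G.IsRegularOfDegree 3)
    (c : G.lineGraph.Coloring (Fin 3)) :
    -- a connected closed two-manifold
    ∃ (S : Type u) (_ : TopologicalSpace S) (_ : T2Space S) (_ : SecondCountableTopology S)
      (_ : CompactSpace S) (_ : ConnectedSpace S)
      (_ : ChartedSpace (EuclideanSpace ℝ (Fin 2)) S)
      -- an embedding of the graph, with its faces identified with the two-colored cycles
      (Γ : GraphEmbedding G S) (face : TwoColoredCycle c ≃ Γ.Face)
      (col : Γ.Face → Fin 3),
      -- the components left after deleting one color are cycles, filled in with disks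
      (∀ K : TwoColoredCycle c, K.IsCycle ∧ BoundsDisk (face K).1 (Γ.edgeImage K.edges)) ∧
      -- closed faces meet exactly along the shared edges
      (∀ K L : TwoColoredCycle c, K ≠ L →
        closure (face K).1 ∩ closure (face L).1 = Γ.edgeImage (K.edges ∩ L.edges)) ∧
      -- the face coloring is proper and induced by the edge coloring
      Γ.IsProperFaceColoring col ∧
      (∀ K : TwoColoredCycle c, col (face K) = K.color) ∧
      -- an edge of color `i` lies on exactly two faces, one of each color other than `i`
      (∀ (e : G.edgeSet) (A : Γ.Face), Γ.OnBoundary e A → col A ≠ c e) ∧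
      (∀ (e : G.edgeSet) (j : Fin 3), j ≠ c e → ∃! A : Γ.Face, col A = j ∧ Γ.OnBoundary e A) := by
  have := hconn.nonempty
  exact ⟨(ColoredFlips.ofColoring hreg c).Surface, inferInstance, inferInstance, inferInstance,
    inferInstance, ColoredFlips.connectedSpace_surface (linked_univ hreg hconn), inferInstance,
    surfaceEmbedding hreg c, cycleEquivFace hreg c, faceColor hreg c,
    fun K => ⟨K.isCycle hreg, boundsDisk_cycleFace hreg K⟩,
    fun _ _ h => closure_cycleFace_inter hreg h, isProperFaceColoring_faceColor hreg,
    faceColor_cycleEquivFace hreg, fun _ _ h => faceColor_ne_of_onBoundary hreg h,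
    fun _ _ hj => existsUnique_face_onBoundary hreg hj⟩
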